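/- Fix an integer $n\ge 1$ and write $[m]=\{1,\dots,m\}$. Let $s_1,\dots,s_{n-1}$ be the simple transpositions of $S_n$ and $\ell(w)$ the length of $w\in S_n$. Let $H_n$ be the finite Hecke algebra of $S_n$: the $\mathbb{Z}[t^{\pm1}]$-algebra with generators $T_1,\dots,T_{n-1}$ and relations $T_i^2=(t-1)T_i+t$, $T_iT_{i+1}T_i=T_{i+1}T_iT_{i+1}$, and $T_iT_j=T_jT_i$ for $|i-j|>1$. Put $T_w=T_{i_1}\cdots T_{i_k}$ for a reduced expression $w=s_{i_1}\cdots s_{i_k}$. Let $S_n$ act on $\mathbb{Z}^n$ by permuting coordinates. For $\mu\in\mathbb{Z}^n$ let $S_{n,\mu}$ be the stabilizer of $\mu$, $H_{n,\mu}$ the subalgebra generated by $\{T_w: w\in S_{n,\mu}\}$, $\mathbf 1_\mu=\sum_{w\in S_{n,\mu}}T_w$ (so $\mathbf 1_0=\sum_{w\in S_n}T_w$), and $W_\mu(t)=\sum_{w\in S_{n,\mu}}t^{\ell(w)}$. Let $\varpi_\ell=\varepsilon_1+\dots+\varepsilon_\ell$. A column of length $\ell$ is a sequence $C=(c_1<\dots<c_\ell)$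 in $[n]$, identified with the subset $\{c_1,\dots,c_\ell\}$; $B(\varpi_\ell)$ is the set of columns of length $\ell$. The group $S_n$ acts on columns through subsets, and for $E,F\in B(\varpi_\ell)$ we write $E\le F$ if $e_i\le f_i$ for all $i$. Let $u_C\in S_n$ be the permutation mapping $1,\dots,\ell$ increasingly onto $C$ and $\ell+1,\dots,n$ increasingly onto $[n]\setminus C$. Every $h\in H_n$ can be written uniquely as $h=\sum_{C\in B(\varpi_\ell)}T_{u_C}h_C$ with $h_C\in H_{n,\varpi_\ell}$. Let $1\le\ell_1\le\dots\le\ell_r\le n$ and let $T=C_r\otimes\dots\otimes C_1$, with $C_i\in B(\varpi_{\ell_i})$, denote the filling with columns $C_r,\dots,C_1$ from left to right, of shape $\lambda=\varpi_{\ell_1}+\dots+\varpi_{\ell_r}$; it is semistandard if its entries increase weakly along rows. Define $\Psi_T\in H_n$ recursively: $\Psi_C=t^{\ell(u_C)}(T_{u_C^{-1}})^{-1}\mathbf 1_{\varpi_\ell}$ for a single column $C\in B(\varpi_\ell)$, and $\Psi_{C\otimes S}=t^{\ell(u_C)}(T_{u_C^{-1}})^{-1}h_C$ for $C\in B(\varpi_\ell)$,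 where $\Psi_S=\sum_{E\in B(\varpi_\ell)}T_{u_E}h_E$ with $h_E\in H_{n,\varpi_\ell}$. (For $r=0$ put $\Psi_\emptyset=\mathbf 1_0$.) **Theorem.** For every such $T$ there is a unique rational function $\widetilde\psi_T$ in $t$ with $$\widetilde\psi_T\,\mathbf 1_0=\frac{1}{W_\lambda(t)}\,\Psi_T\,\mathbf 1_0 ,$$ where $\lambda$ is the shape of $T$ (an equation in $\mathbb{Q}(t)\otimes_{\mathbb{Z}[t^{\pm1}]}H_n$), and the following hold. 1. If $T=C_r\otimes\dots\otimes C_1$ with $C_i\in B(\varpi_{\ell_i})$ and $1\le\ell_1\le\dots\le\ell_r\le n$, then $$\widetilde\psi_T=\prod_{j=1}^{r-1}\widetilde\psi_{C_{j+1}\otimes C_j}.$$ 2. Let $1\le a\le b\le n$. For $F\in B(\varpi_b)$ and $E\in B(\varpi_a)$, the $\widetilde\psi_{F\otimes E}$ satisfy, and are uniquely determined by, the following: (a) if $F\otimes E$ is not semistandard, then $\widetilde\psi_{F\otimes E}=0$; (b) if $E=(1,\dots,a)$ and $F\otimes E$ is semistandard, then $\widetilde\psi_{F\otimes E}=1$;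 (c) if $F\otimes E$ is semistandard and $j\in[n-1]$ is such that $s_jE\le E$, then $$\widetilde\psi_{F\otimes E}=\begin{cases}t\,\widetilde\psi_{s_jF\otimes s_jE}+(1-t)\,\widetilde\psi_{F\otimes s_jE}, & \text{if } s_jF\ge F,\\ \widetilde\psi_{s_jF\otimes s_jE}, & \text{if } s_jF\le F.\end{cases}$$ -/

import Mathlib

namespace HeckeTableaux

open scoped TensorProduct LaurentPolynomial

noncomputable section

/-! ### The symmetric group `S_n`, acting on `Fin n` (so the letters `1, …, n` become `0, …, n-1`) -/

/-- The letter `j` of `[n]`, for `j ∈ [n-1]`. -/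
def lo {n : ℕ} (j : Fin (n - 1)) : Fin n := ⟨j.val, by omega⟩

/-- The letter `j + 1` of `[n]`, for `j ∈ [n-1]`. -/
def hi {n : ℕ} (j : Fin (n - 1)) : Fin n := ⟨j.val + 1, by omega⟩

/-- The simple transposition `s_j = (j, j+1)`. -/
def simple {n : ℕ} (j : Fin (n - 1)) : Equiv.Perm (Fin n) := Equiv.swap (lo j) (hi j)

/-- The permutation spelled by a word in the simple transpositions. -/
def wordProd {n : ℕ} (L : List (Fin (n - 1))) : Equiv.Perm (Fin n) := (L.map simple).prod

/-- The length `ℓ(w)`: the smallest length of a word for `w`. -/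
def len {n : ℕ} (w : Equiv.Perm (Fin n)) : ℕ :=
  sInf {k : ℕ | ∃ L : List (Fin (n - 1)), wordProd L = w ∧ L.length = k}

theorem exists_word {n : ℕ} (w : Equiv.Perm (Fin n)) :
    ∃ L : List (Fin (n - 1)), wordProd L = w := by
  cases n with
  | zero => exact ⟨[], Subsingleton.elim _ _⟩
  | succ m =>
    have hw : w ∈ Submonoid.closure
        (Set.range fun i : Fin m => Equiv.swap i.castSucc i.succ) := by
      rw [Equiv.Perm.mclosure_swap_castSucc_succ]; trivial
    induction hw using Submonoid.closure_induction with
    | mem x hx =>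
      obtain ⟨i, rfl⟩ := hx
      exact ⟨[i], by simp only [wordProd, List.map_cons, List.map_nil, List.prod_singleton]; rfl⟩
    | one => exact ⟨[], rfl⟩
    | mul x y _ _ hx hy =>
      obtain ⟨L, rfl⟩ := hx
      obtain ⟨M, rfl⟩ := hy
      exact ⟨L ++ M, by simp [wordProd]⟩

theorem exists_reduced_word {n : ℕ} (w : Equiv.Perm (Fin n)) :
    ∃ L : List (Fin (n - 1)), wordProd L = w ∧ L.length = len w := by
  obtain ⟨L, hL⟩ := exists_word w
  have h : {k : ℕ | ∃ L : List (Fin (n - 1)), wordProd L = w ∧ L.length = k}.Nonempty :=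
    ⟨L.length, L, hL, rfl⟩
  exact Nat.sInf_mem h

/-- A reduced expression of `w`. -/
def reducedWord {n : ℕ} (w : Equiv.Perm (Fin n)) : List (Fin (n - 1)) :=
  (exists_reduced_word w).choose

/-- The action of `S_n` on `ℤ^n` by permuting coordinates. -/
def permAct {n : ℕ} (w : Equiv.Perm (Fin n)) (μ : Fin n → ℤ) : Fin n → ℤ := fun i => μ (w⁻¹ i)

/-- The stabilizer `S_{n,μ} = {w ∈ S_n | w μ = μ}`. -/
def stab {n : ℕ} (μ : Fin n → ℤ) : Finset (Equiv.Perm (Fin n)) :=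
  Finset.univ.filter fun w => permAct w μ = μ

/-- The fundamental weight `ϖ_ℓ = ε_1 + ⋯ + ε_ℓ`. -/
def fundWeight (n ℓ : ℕ) : Fin n → ℤ := fun i => if i.val < ℓ then 1 else 0

/-! ### The finite Hecke algebra `H_n` over `ℤ[t, t⁻¹]` -/

/-- The power `t^k` in `ℤ[t, t⁻¹]`. -/
def tpow (k : ℕ) : ℤ[T;T⁻¹] := LaurentPolynomial.T (k : ℤ)

/-- The quadratic and braid relations between the generators `T_1, …, T_{n-1}`. -/
inductive HeckeRel (n : ℕ) :
    FreeAlgebra ℤ[T;T⁻¹] (Fin (n - 1)) → FreeAlgebra ℤ[T;T⁻¹] (Fin (n - 1)) → Prop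
  | quad (i : Fin (n - 1)) :
      HeckeRel n (FreeAlgebra.ι _ i * FreeAlgebra.ι _ i)
        ((tpow 1 - 1) • FreeAlgebra.ι _ i + tpow 1 • (1 : FreeAlgebra ℤ[T;T⁻¹] (Fin (n - 1))))
  | braid (i j : Fin (n - 1)) (h : j.val = i.val + 1) :
      HeckeRel n (FreeAlgebra.ι _ i * FreeAlgebra.ι _ j * FreeAlgebra.ι _ i)
        (FreeAlgebra.ι _ j * FreeAlgebra.ι _ i * FreeAlgebra.ι _ j)
  | comm (i j : Fin (n - 1)) (h : i.val + 1 < j.val) :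
      HeckeRel n (FreeAlgebra.ι _ i * FreeAlgebra.ι _ j)
        (FreeAlgebra.ι _ j * FreeAlgebra.ι _ i)

/-- The finite Hecke algebra `H_n`. -/
abbrev Hecke (n : ℕ) : Type := RingQuot (HeckeRel n)

/-- The generator `T_i` of `H_n`. -/
def gen {n : ℕ} (i : Fin (n - 1)) : Hecke n :=
  RingQuot.mkAlgHom ℤ[T;T⁻¹] (HeckeRel n) (FreeAlgebra.ι _ i)

/-- `T_w = T_{i_1} ⋯ T_{i_k}` for a reduced expression `w = s_{i_1} ⋯ s_{i_k}`
(by the braid relations the choice does not matter). -/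
def Tw {n : ℕ} (w : Equiv.Perm (Fin n)) : Hecke n := ((reducedWord w).map gen).prod

/-- The parabolic symmetrizer `1_μ = ∑_{w ∈ S_{n,μ}} T_w`. -/
def symmetrizer {n : ℕ} (μ : Fin n → ℤ) : Hecke n := ∑ w ∈ stab μ, Tw w

/-- The symmetrizer `1_0 = ∑_{w ∈ S_n} T_w`. -/
def one0 (n : ℕ) : Hecke n := ∑ w : Equiv.Perm (Fin n), Tw w

/-- The Poincaré polynomial `W_μ(t) = ∑_{w ∈ S_{n,μ}} t^{ℓ(w)}`. -/
def poincare {n : ℕ} (μ : Fin n → ℤ) : ℤ[T;T⁻¹] := ∑ w ∈ stab μ, tpow (len w)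

/-- The parabolic subalgebra `H_{n,μ}`, generated by the `T_w` with `w ∈ S_{n,μ}`. -/
def parabolic {n : ℕ} (μ : Fin n → ℤ) : Subalgebra ℤ[T;T⁻¹] (Hecke n) :=
  Algebra.adjoin ℤ[T;T⁻¹] {x | ∃ w ∈ stab μ, x = Tw w}

/-! ### Columns and fillings

A column `c_1 < ⋯ < c_ℓ` is identified with the subset `{c_1, …, c_ℓ}` of `[n]`, so that `B(ϖ_ℓ)`
consists of the subsets of size `ℓ`. A filling `C_r ⊗ ⋯ ⊗ C_1` is the list `[C_r, …, C_1]` of its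
columns from left to right. -/

/-- The action of `S_n` on columns. -/
def permCol {n : ℕ} (w : Equiv.Perm (Fin n)) (C : Finset (Fin n)) : Finset (Fin n) :=
  C.map w.toEmbedding

/-- The order on columns of the same length: `E ≤ F` if `e_i ≤ f_i` for all `i`. -/
def ColLE {n : ℕ} (E F : Finset (Fin n)) : Prop :=
  ∃ h : F.card = E.card, ∀ i : Fin E.card, E.orderEmbOfFin rfl i ≤ F.orderEmbOfFin h i

/-- The two-column filling `F ⊗ E` (`F` on the left, at least as long as `E`) is semistandard:
its entries increase weakly along each row. -/
def Semistandard {n : ℕ} (F E : Finset (Fin n)) : Prop :=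
  ∃ h : E.card ≤ F.card, ∀ i : Fin E.card,
    F.orderEmbOfFin rfl (Fin.castLE h i) ≤ E.orderEmbOfFin rfl i

/-- The highest weight column `(1, …, ℓ)`. -/
def highestCol (n ℓ : ℕ) : Finset (Fin n) := Finset.univ.filter fun i => i.val < ℓ

/-- The permutation `u_C`, which maps `1, …, ℓ` increasingly onto `C` and `ℓ+1, …, n` increasingly
onto the complement of `C`, where `ℓ` is the length of `C`. -/
def colPerm {n : ℕ} (C : Finset (Fin n)) : Equiv.Perm (Fin n) :=
  (finCongr (by rw [Finset.card_add_card_compl, Fintype.card_fin] : n = C.card + Cᶜ.card)).trans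
    (finSumFinEquiv.symm.trans (finSumEquivOfFinset (s := C) rfl rfl))

/-- The list of columns is a column-strict filling of a partition shape, i.e. it belongs to
`B(ϖ_{ℓ_r}) ⊗ ⋯ ⊗ B(ϖ_{ℓ_1})` for some `1 ≤ ℓ_1 ≤ ⋯ ≤ ℓ_r ≤ n`. -/
def IsFilling {n : ℕ} (T : List (Finset (Fin n))) : Prop :=
  (∀ C ∈ T, 1 ≤ C.card) ∧ T.Pairwise fun C D => D.card ≤ C.card

/-- The shape `λ = ϖ_{ℓ_r} + ⋯ + ϖ_{ℓ_1}` of a filling with columns of lengths `ℓ_r, …, ℓ_1`. -/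
def shape {n : ℕ} (T : List (Finset (Fin n))) : Fin n → ℤ :=
  (T.map fun C => fundWeight n C.card).sum

/-! ### The elements `Ψ_T` and the scalars `ψ̃_T` -/

/-- `h = ∑_{C ∈ B(ϖ_ℓ)} T_{u_C} h_C` with all `h_C` in `H_{n,ϖ_ℓ}`. -/
def IsParabolicExpansion {n : ℕ} (ℓ : ℕ) (h : Hecke n) (c : Finset (Fin n) → Hecke n) : Prop :=
  (∀ C ∈ Finset.powersetCard ℓ Finset.univ, c C ∈ parabolic (fundWeight n ℓ)) ∧
    h = ∑ C ∈ Finset.powersetCard ℓ Finset.univ, Tw (colPerm C) * c C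

/-- The coefficients `h_C`, `C ∈ B(ϖ_ℓ)`, of the (unique) parabolic expansion of `h`. -/
def parabolicCoeff {n : ℕ} (ℓ : ℕ) (h : Hecke n) : Finset (Fin n) → Hecke n :=
  Classical.epsilon (IsParabolicExpansion ℓ h)

/-- `t^{ℓ(u_C)} (T_{u_C⁻¹})⁻¹`. Every `T_w` is a unit of `H_n`, so `Ring.inverse` is the inverse. -/
def colElt {n : ℕ} (C : Finset (Fin n)) : Hecke n :=
  tpow (len (colPerm C)) • Ring.inverse (Tw (colPerm C)⁻¹)

/-- The elements `Ψ_T ∈ H_n`, by recursion on the number of columns. The filling without columns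
(of shape `0`) gets `1_0`. -/
def Psi {n : ℕ} : List (Finset (Fin n)) → Hecke n
  | [] => one0 n
  | [C] => colElt C * symmetrizer (fundWeight n C.card)
  | C :: D :: S => colElt C * parabolicCoeff C.card (Psi (D :: S)) C

/-- The field of rational functions in `t`, as the fraction field of `ℤ[t, t⁻¹]`. -/
abbrev K : Type := FractionRing ℤ[T;T⁻¹]

/-- The variable `t` in the field of rational functions. -/
def tK : K := algebraMap ℤ[T;T⁻¹] K (tpow 1)

/-- The embedding of `H_n` into its extension of scalars to the field of rational functions. -/
def extend {n : ℕ} : Hecke n →ₐ[ℤ[T;T⁻¹]] K ⊗[ℤ[T;T⁻¹]] Hecke n :=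
  Algebra.TensorProduct.includeRight

/-- The defining equation `c 1_0 = (1 / W_λ(t)) Ψ_T 1_0` of `c = ψ̃_T`, with `λ` the shape of `T`. -/
def IsPsiTilde {n : ℕ} (T : List (Finset (Fin n))) (c : K) : Prop :=
  c • extend (one0 n) =
    (algebraMap ℤ[T;T⁻¹] K (poincare (shape T)))⁻¹ • extend (Psi T * one0 n)

/-- The scalar `ψ̃_T`. -/
def psiTilde {n : ℕ} (T : List (Finset (Fin n))) : K := Classical.epsilon (IsPsiTilde T)

/-- The recursions for a family `φ F E` indexed by the columns `F ∈ B(ϖ_b)` and `E ∈ B(ϖ_a)`. -/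
structure SatisfiesRecursions {n : ℕ} (a b : ℕ) (φ : Finset (Fin n) → Finset (Fin n) → K) :
    Prop where
  not_semistandard : ∀ F E : Finset (Fin n), F.card = b → E.card = a →
    ¬ Semistandard F E → φ F E = 0
  highest_weight : ∀ F E : Finset (Fin n), F.card = b → E.card = a →
    E = highestCol n a → Semistandard F E → φ F E = 1
  rec_ge : ∀ F E : Finset (Fin n), F.card = b → E.card = a → Semistandard F E →
    ∀ j : Fin (n - 1), ColLE (permCol (simple j) E) E → ColLE F (permCol (simple j) F) →
      φ F E = tK * φ (permCol (simple j) F) (permCol (simple j) E) +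
        (1 - tK) * φ F (permCol (simple j) E)
  rec_le : ∀ F E : Finset (Fin n), F.card = b → E.card = a → Semistandard F E →
    ∀ j : Fin (n - 1), ColLE (permCol (simple j) E) E → ColLE (permCol (simple j) F) F →
      φ F E = φ (permCol (simple j) F) (permCol (simple j) E)

end

end HeckeTableaux

open HeckeTableaux

namespace HeckeTableaux

open scoped TensorProduct LaurentPolynomial

noncomputable section

/-! The character χ : T_i ↦ t satisfies x 1_0 = χ(x) 1_0 (`mul_one0`), so ψ̃_T = χ(Ψ_T) / W_λ
(`psiTilde_eq`). The prefix t^{ℓ(u_C)} (T_{u_C⁻¹})⁻¹ has character 1, hence χ(Ψ_{C⊗S}) = χ(h_C),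
where h_C is the coefficient of Ψ_S at C. This is a matrix coefficient. Let H_n act on functions on
ℤ^n by `rep`; then H_{n,ϖ_b} acts on e_{ϖ_b} through χ and T_{u_C} e_{ϖ_b} = e_C, so χ(h_C) is the
value of Ψ_S e_{ϖ_b} at the weight of C (`IsParabolicExpansion.rep_apply`).

Product formula: let D, of length d ≤ b, be the first of several columns of S, and write Ψ_S =
`colElt D` * c with c in H_{n,ϖ_d}. Right multiplication by a generator beyond d multiplies c by t,
and a generator below d multiplies e_{ϖ_b} by t. Summing c T_v e_{ϖ_b} over the stabilizer of ϖ_d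
therefore gives W_{ϖ_d} c e_{ϖ_b} = c 1_{ϖ_d} e_{ϖ_b} = χ(c) 1_{ϖ_d} e_{ϖ_b}. So Ψ_S e_{ϖ_b} is
proportional to Ψ_D e_{ϖ_b} (`poincare_smul_rep_Psi`). The normalizations agree because W_ν /
W_{ν+ϖ_b} depends on ν only through its support (`poincare_eq`).

Two columns: T_j Ψ_E = t Ψ_{s_jE} if s_jE ≤ E (`gen_mul_Psi`); inverting T_j and evaluating at F
gives the recursions. They start from 1_{ϖ_a} e_{ϖ_b}, which is W_{ϖ_a+ϖ_b} times the sum of the e_F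
with F ⊇ {1, …, a} (`psiNum_highestCol`). Vanishing and uniqueness follow by induction, lowering E
to the highest weight column. -/

variable {n : ℕ}

/-! ### Lengths, inversions and reduced words. -/

theorem lo_lt_hi (j : Fin (n - 1)) : lo j < hi j := by
  simp [lo, hi]

theorem simple_mul_self (j : Fin (n - 1)) : simple j * simple j = 1 := Equiv.swap_mul_self _ _

theorem simple_simple (j : Fin (n - 1)) (p : Fin n) : simple j (simple j p) = p :=
  Equiv.swap_apply_self _ _ _

theorem simple_inv (j : Fin (n - 1)) : (simple j)⁻¹ = simple j := Equiv.swap_inv _ _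

theorem simple_lo (j : Fin (n - 1)) : simple j (lo j) = hi j := Equiv.swap_apply_left _ _

theorem simple_hi (j : Fin (n - 1)) : simple j (hi j) = lo j := Equiv.swap_apply_right _ _

theorem mul_simple_simple (w : Equiv.Perm (Fin n)) (j : Fin (n - 1)) :
    w * simple j * simple j = w := by
  rw [mul_assoc, simple_mul_self, mul_one]

theorem simple_mul_simple (w : Equiv.Perm (Fin n)) (j : Fin (n - 1)) :
    simple j * (simple j * w) = w := by
  rw [← mul_assoc, simple_mul_self, one_mul]

theorem simple_lt_simple (j : Fin (n - 1)) {p q : Fin n} (h : p < q)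
    (hne : ¬ (p = lo j ∧ q = hi j)) : simple j p < simple j q := by
  simp only [simple, Equiv.swap_apply_def]
  simp only [lo, hi, Fin.ext_iff, Fin.lt_def] at *
  split_ifs <;> (try simp only) <;> omega

/-- The set of inversions of a permutation. -/
def inversions (w : Equiv.Perm (Fin n)) : Finset (Fin n × Fin n) :=
  Finset.univ.filter fun p => p.1 < p.2 ∧ w p.2 < w p.1

theorem mem_inversions {w : Equiv.Perm (Fin n)} {p q : Fin n} :
    (p, q) ∈ inversions w ↔ p < q ∧ w q < w p := by
  simp [inversions]

/-- Applying s_j to both positions is a bijection on inversions, apart from the pair (`lo j`, `hi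
j`), which is the one new inversion. -/
theorem card_inversions_mul_simple {w : Equiv.Perm (Fin n)} {j : Fin (n - 1)}
    (h : w (lo j) < w (hi j)) :
    (inversions (w * simple j)).card = (inversions w).card + 1 := by
  classical
  have hmem : (lo j, hi j) ∈ inversions (w * simple j) := by
    simp [mem_inversions, lo_lt_hi, simple_lo, simple_hi, h]
  rw [← Finset.card_erase_add_one hmem]
  congr 1
  refine Finset.card_nbij' (fun p => (simple j p.1, simple j p.2))
    (fun p => (simple j p.1, simple j p.2)) ?_ ?_ ?_ ?_
  · rintro ⟨p, q⟩ hp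
    simp only [Finset.mem_coe, Finset.mem_erase, mem_inversions, ne_eq, Prod.mk.injEq,
      Equiv.Perm.mul_apply] at hp ⊢
    exact ⟨simple_lt_simple j hp.2.1 hp.1, hp.2.2⟩
  · rintro ⟨p, q⟩ hp
    simp only [Finset.mem_coe, Finset.mem_erase, mem_inversions, ne_eq, Prod.mk.injEq,
      Equiv.Perm.mul_apply, simple_simple] at hp ⊢
    have hne : ¬ (p = lo j ∧ q = hi j) := by
      rintro ⟨rfl, rfl⟩
      exact absurd hp.2 (not_lt.2 h.le)
    refine ⟨?_, simple_lt_simple j hp.1 hne, hp.2⟩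
    rintro ⟨h1, h2⟩
    have h1' : p = hi j := by rw [← simple_simple j p, h1, simple_lo]
    have h2' : q = lo j := by rw [← simple_simple j q, h2, simple_hi]
    subst h1' h2'
    exact absurd hp.1 (not_lt.2 (lo_lt_hi j).le)
  · rintro ⟨p, q⟩ _
    simp [simple_simple]
  · rintro ⟨p, q⟩ _
    simp [simple_simple]

theorem apply_lo_ne_apply_hi (w : Equiv.Perm (Fin n)) (j : Fin (n - 1)) : w (lo j) ≠ w (hi j) :=
  fun h => (lo_lt_hi j).ne (w.injective h)

theorem card_inversions_mul_simple_of_gt {w : Equiv.Perm (Fin n)} {j : Fin (n - 1)}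
    (h : w (hi j) < w (lo j)) :
    (inversions (w * simple j)).card + 1 = (inversions w).card := by
  have := card_inversions_mul_simple (w := w * simple j) (j := j)
    (by simpa [simple_lo, simple_hi] using h)
  rw [mul_simple_simple] at this
  exact this.symm

/-- Without descents both w and its inverse are strictly increasing, and a strictly increasing
self-map of `Fin n` lies above the identity. -/
theorem exists_descent {w : Equiv.Perm (Fin n)} (hw : w ≠ 1) :
    ∃ j : Fin (n - 1), w (hi j) < w (lo j) := by
  by_contra! h
  apply hw
  have hm : StrictMono w := by
    cases n with
    | zero => exact fun a => a.elim0
    | succ m =>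
      rw [Fin.strictMono_iff_lt_succ]
      intro i
      exact lt_of_le_of_ne (h i) (apply_lo_ne_apply_hi w i)
  have hm' : StrictMono (w⁻¹ : Equiv.Perm (Fin n)) := fun p q hpq => by
    rw [← hm.lt_iff_lt]
    simpa using hpq
  ext i : 1
  exact le_antisymm (by simpa using hm'.le_apply (x := w i)) hm.le_apply

theorem wordProd_nil : wordProd ([] : List (Fin (n - 1))) = 1 := rfl

theorem wordProd_cons (i : Fin (n - 1)) (L : List (Fin (n - 1))) :
    wordProd (i :: L) = simple i * wordProd L := by simp [wordProd]

theorem wordProd_append (L M : List (Fin (n - 1))) :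
    wordProd (L ++ M) = wordProd L * wordProd M := by simp [wordProd]

theorem wordProd_reverse (L : List (Fin (n - 1))) : wordProd L.reverse = (wordProd L)⁻¹ := by
  induction L with
  | nil => simp [wordProd]
  | cons i L ih =>
    rw [List.reverse_cons, wordProd_append, ih, wordProd_cons i [], wordProd_cons, mul_inv_rev,
      wordProd_nil, mul_one, simple_inv]

theorem len_le_length (L : List (Fin (n - 1))) : len (wordProd L) ≤ L.length :=
  Nat.sInf_le ⟨L, rfl, rfl⟩

theorem card_inversions_le_length (L : List (Fin (n - 1))) :
    (inversions (wordProd L)).card ≤ L.length := by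
  induction L using List.reverseRecOn with
  | nil =>
    simp only [wordProd_nil, List.length_nil, nonpos_iff_eq_zero, Finset.card_eq_zero]
    ext ⟨p, q⟩
    simp only [mem_inversions, Equiv.Perm.one_apply, Finset.notMem_empty, iff_false]
    exact fun h => lt_asymm h.1 h.2
  | append_singleton L i ih =>
    rw [wordProd_append, wordProd_cons, wordProd_nil, mul_one, List.length_append,
      List.length_singleton]
    rcases lt_or_gt_of_ne (apply_lo_ne_apply_hi (wordProd L) i) with h | h
    · rw [card_inversions_mul_simple h]; omega
    · have := card_inversions_mul_simple_of_gt h; omega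

/-- Bubble sort: each descent removed costs one letter and one inversion. -/
theorem exists_word_card_inversions (w : Equiv.Perm (Fin n)) :
    ∃ L : List (Fin (n - 1)), wordProd L = w ∧ L.length = (inversions w).card := by
  induction hk : (inversions w).card using Nat.strong_induction_on generalizing w with
  | _ k ih =>
    by_cases hw : w = 1
    · subst hw
      refine ⟨[], rfl, ?_⟩
      have := card_inversions_le_length ([] : List (Fin (n - 1)))
      rw [wordProd_nil] at this
      simp only [List.length_nil] at this ⊢
      omega
    · obtain ⟨j, hj⟩ := exists_descent hw
      have h1 := card_inversions_mul_simple_of_gt hj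
      obtain ⟨L, hL, hl⟩ := ih _ (by omega) (w * simple j) rfl
      refine ⟨L ++ [j], ?_, ?_⟩
      · rw [wordProd_append, hL, wordProd_cons, wordProd_nil, mul_one, mul_simple_simple]
      · rw [List.length_append, hl, List.length_singleton]; omega

theorem len_eq_card_inversions (w : Equiv.Perm (Fin n)) : len w = (inversions w).card := by
  apply le_antisymm
  · obtain ⟨L, hL, hl⟩ := exists_word_card_inversions w
    rw [← hl, ← hL]
    exact len_le_length L
  · obtain ⟨L, hL, hl⟩ := exists_reduced_word w
    rw [← hl, ← hL]
    exact card_inversions_le_length L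

theorem len_mul_simple {w : Equiv.Perm (Fin n)} {j : Fin (n - 1)} (h : w (lo j) < w (hi j)) :
    len (w * simple j) = len w + 1 := by
  simpa only [len_eq_card_inversions] using card_inversions_mul_simple h

theorem len_mul_simple_of_gt {w : Equiv.Perm (Fin n)} {j : Fin (n - 1)}
    (h : w (hi j) < w (lo j)) : len (w * simple j) + 1 = len w := by
  simpa only [len_eq_card_inversions] using card_inversions_mul_simple_of_gt h

theorem len_inv (w : Equiv.Perm (Fin n)) : len w⁻¹ = len w := by
  have key : ∀ v : Equiv.Perm (Fin n), len v⁻¹ ≤ len v := by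
    intro v
    obtain ⟨L, hL, hl⟩ := exists_reduced_word v
    rw [← hl, ← hL, ← wordProd_reverse, ← List.length_reverse]
    exact len_le_length _
  exact le_antisymm (key w) (by simpa using key w⁻¹)

theorem len_simple_mul {w : Equiv.Perm (Fin n)} {j : Fin (n - 1)} (h : w⁻¹ (lo j) < w⁻¹ (hi j)) :
    len (simple j * w) = len w + 1 := by
  rw [← len_inv, mul_inv_rev, simple_inv, len_mul_simple h, len_inv]

theorem len_simple_mul_of_gt {w : Equiv.Perm (Fin n)} {j : Fin (n - 1)}
    (h : w⁻¹ (hi j) < w⁻¹ (lo j)) : len (simple j * w) + 1 = len w := by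
  rw [← len_inv, mul_inv_rev, simple_inv, len_mul_simple_of_gt h, len_inv]

theorem len_one : len (1 : Equiv.Perm (Fin n)) = 0 :=
  Nat.le_zero.1 (len_le_length ([] : List (Fin (n - 1))))

/-- A first letter that shortened the product of the tail would make the whole word longer than the
length of its product. -/
theorem inv_gt_of_reduced_cons {i : Fin (n - 1)} {L : List (Fin (n - 1))}
    (h : (i :: L).length = len (wordProd (i :: L))) :
    (wordProd (i :: L))⁻¹ (hi i) < (wordProd (i :: L))⁻¹ (lo i) ∧
      L.length = len (wordProd L) := by
  rw [wordProd_cons, List.length_cons] at h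
  have h1 := len_le_length L
  rcases lt_or_gt_of_ne (apply_lo_ne_apply_hi (wordProd L)⁻¹ i) with h' | h'
  · rw [len_simple_mul h'] at h
    refine ⟨?_, by omega⟩
    simpa [wordProd_cons, simple_inv, simple_lo, simple_hi] using h'
  · have := len_simple_mul_of_gt h'
    omega

theorem simple_apply_of_ne {j : Fin (n - 1)} {p : Fin n} (h1 : p ≠ lo j) (h2 : p ≠ hi j) :
    simple j p = p := Equiv.swap_apply_of_ne_of_ne h1 h2

/-! ### The defining relations and Matsumoto's theorem for `Tw`. -/

theorem gen_mul_self (i : Fin (n - 1)) :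
    (gen i * gen i : Hecke n) = (tpow 1 - 1) • gen i + tpow 1 • 1 := by
  have := RingQuot.mkAlgHom_rel ℤ[T;T⁻¹] (HeckeRel.quad i)
  simp only [map_mul, map_add, map_smul, map_one] at this
  exact this

theorem gen_braid {i j : Fin (n - 1)} (h : j.val = i.val + 1) :
    (gen i * gen j * gen i : Hecke n) = gen j * gen i * gen j := by
  have := RingQuot.mkAlgHom_rel ℤ[T;T⁻¹] (HeckeRel.braid i j h)
  simp only [map_mul] at this
  exact this

theorem gen_comm {i j : Fin (n - 1)} (h : i.val + 1 < j.val) :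
    (gen i * gen j : Hecke n) = gen j * gen i := by
  have := RingQuot.mkAlgHom_rel ℤ[T;T⁻¹] (HeckeRel.comm i j h)
  simp only [map_mul] at this
  exact this

theorem simple_comm {i j : Fin (n - 1)} (h : i.val + 1 < j.val) :
    simple i * simple j = simple j * simple i := by
  ext p
  simp only [Equiv.Perm.mul_apply, simple, Equiv.swap_apply_def, lo, hi, Fin.ext_iff]
  split_ifs <;> simp only at * <;> omega

theorem hi_eq_lo {i j : Fin (n - 1)} (h : j.val = i.val + 1) : hi i = lo j := by
  simp [lo, hi, h]

theorem simple_braid {i j : Fin (n - 1)} (h : j.val = i.val + 1) :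
    simple i * simple j * simple i = simple j * simple i * simple j := by
  have e := hi_eq_lo h
  have h1 : lo i ≠ lo j := by rw [← e]; exact (lo_lt_hi i).ne
  have h2 : lo j ≠ hi j := (lo_lt_hi j).ne
  have h3 : lo i ≠ hi j := by
    simp only [lo, hi, ne_eq, Fin.ext_iff]; omega
  unfold simple
  rw [e]
  rw [Equiv.swap_mul_swap_mul_swap (by exact h1) (by exact h3)]
  rw [Equiv.swap_comm (lo i) (lo j), Equiv.swap_comm (lo j) (hi j),
    Equiv.swap_mul_swap_mul_swap (by exact h2.symm) (by exact h3.symm), Equiv.swap_comm]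

theorem exists_reduced_cons {w : Equiv.Perm (Fin n)} {j : Fin (n - 1)} {M : List (Fin (n - 1))}
    (hM : wordProd M = simple j * w) (hl : M.length = len (simple j * w))
    (h : w⁻¹ (hi j) < w⁻¹ (lo j)) :
    wordProd (j :: M) = w ∧ (j :: M).length = len w := by
  constructor
  · rw [wordProd_cons, hM, simple_mul_simple]
  · rw [List.length_cons, hl, len_simple_mul_of_gt h]

/-- Two reduced words for the same permutation give the same product of generators. -/
theorem prod_gen_eq_of_reduced (L L' : List (Fin (n - 1)))
    (hL : L.length = len (wordProd L)) (hL' : L'.length = len (wordProd L'))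
    (h : wordProd L = wordProd L') :
    (L.map gen).prod = ((L'.map gen).prod : Hecke n) := by
  induction hk : L.length generalizing L L' with
  | zero =>
    have h0 : L'.length = 0 := by rw [hL', ← h, ← hL, hk]
    rw [List.length_eq_zero_iff] at hk h0
    rw [hk, h0]
  | succ k ih =>
    have hk' : L'.length = k + 1 := by rw [hL', ← h, ← hL, hk]
    obtain ⟨i, L₁, rfl⟩ := List.exists_cons_of_length_eq_add_one hk
    obtain ⟨j, L₂, rfl⟩ := List.exists_cons_of_length_eq_add_one hk'
    obtain ⟨hi1, hr1⟩ := inv_gt_of_reduced_cons hL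
    obtain ⟨hj1, hr2⟩ := inv_gt_of_reduced_cons hL'
    have e1 : wordProd L₁ = simple i * wordProd (i :: L₁) := by
      rw [wordProd_cons, simple_mul_simple]
    have e2 : wordProd L₂ = simple j * wordProd (i :: L₁) := by
      rw [h, wordProd_cons, simple_mul_simple]
    rw [← h] at hj1
    simp only [List.length_cons, Nat.add_right_cancel_iff] at hk hk'
    -- The claim is symmetric in the two words, so only i = j, distant letters and adjacent letters
    -- remain.
    wlog hij : i ≤ j generalizing i j L₁ L₂
    · refine (this j L₂ hL' i L₁ hL h.symm ?_ hr2 ?_ hr1 ?_ ?_ hk' hk (le_of_not_ge hij)).symm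
      all_goals rw [← h]; assumption
    simp only [List.map_cons, List.prod_cons]
    generalize wordProd (i :: L₁) = w at *
    rcases hij.eq_or_lt with rfl | hlt
    · rw [ih L₁ L₂ hr1 hr2 (by rw [e1, e2]) hk]
    rcases Nat.lt_or_ge (i.val + 1) j.val with hd | hd
    -- Both letters are left descents of w, so i j M and j i M are reduced words for w. Each shares
    -- its first letter with one given word, so induction applies to the tails.
    · obtain ⟨M, hM, hl⟩ := exists_reduced_word (simple j * (simple i * w))
      have n1 : lo j ≠ lo i := by simp only [lo, ne_eq, Fin.ext_iff]; omega
      have n2 : lo j ≠ hi i := by simp only [lo, hi, ne_eq, Fin.ext_iff]; omega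
      have n3 : hi j ≠ lo i := by simp only [lo, hi, ne_eq, Fin.ext_iff]; omega
      have n4 : hi j ≠ hi i := by simp only [hi, ne_eq, Fin.ext_iff]; omega
      obtain ⟨a1, a2⟩ := exists_reduced_cons hM hl (by
        simpa [mul_inv_rev, simple_inv, simple_apply_of_ne n1 n2, simple_apply_of_ne n3 n4]
          using hj1)
      have hc : simple j * (simple i * w) = simple i * (simple j * w) := by
        rw [← mul_assoc, ← simple_comm hd, mul_assoc]
      rw [hc] at hM hl
      obtain ⟨b1, b2⟩ := exists_reduced_cons hM hl (by
        simpa [mul_inv_rev, simple_inv, simple_apply_of_ne n1.symm n3.symm,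
          simple_apply_of_ne n2.symm n4.symm] using hi1)
      rw [ih L₁ (j :: M) hr1 (by rw [a1, a2]) (by rw [a1, e1]) hk,
        ih L₂ (i :: M) hr2 (by rw [b1, b2]) (by rw [b1, e2]) hk']
      simp only [List.map_cons, List.prod_cons, ← mul_assoc, gen_comm hd]
    · have hd : j.val = i.val + 1 := by
        have := Fin.lt_def.1 hlt
        omega
      have e := hi_eq_lo hd
      have n1 : lo i ≠ hi j := by simp only [lo, hi, ne_eq, Fin.ext_iff]; omega
      have n2 : lo i ≠ lo j := by rw [← e]; exact (lo_lt_hi i).ne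
      have n3 : hi j ≠ hi i := by rw [e]; exact (lo_lt_hi j).ne'
      have si1 : simple i (lo j) = lo i := by rw [← e, simple_hi]
      have si2 : simple i (hi j) = hi j := simple_apply_of_ne n1.symm n3
      have si3 : simple i (lo i) = lo j := by rw [← e, simple_lo]
      have sj1 : simple j (lo i) = lo i := simple_apply_of_ne n2 n1
      rw [e] at hi1
      have hc : simple i * (simple j * (simple i * w)) = simple j * (simple i * (simple j * w)) := by
        simp only [← mul_assoc]; rw [simple_braid hd]
      -- Both descents together force w to begin with the longest element of ⟨s_i, s_j⟩; i j i M and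
      -- j i j M are the intermediate reduced words.
      obtain ⟨M, hM, hl⟩ := exists_reduced_word (simple i * (simple j * (simple i * w)))
      obtain ⟨a1, a2⟩ := exists_reduced_cons hM hl (by
        simpa [mul_inv_rev, simple_inv, si1, si2, si3, sj1, e, simple_lo, simple_hi] using hj1)
      obtain ⟨a3, a4⟩ := exists_reduced_cons a1 a2 (by
        simpa [mul_inv_rev, simple_inv, si1, si2, si3, sj1, e, simple_lo, simple_hi] using
          hj1.trans hi1)
      rw [hc] at hM hl
      obtain ⟨b1, b2⟩ := exists_reduced_cons hM hl (by
        simpa [mul_inv_rev, simple_inv, si1, si2, si3, sj1, e, simple_lo, simple_hi] using hi1)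
      obtain ⟨b3, b4⟩ := exists_reduced_cons b1 b2 (by
        simpa [mul_inv_rev, simple_inv, si1, si2, si3, sj1, e, simple_lo, simple_hi] using
          hj1.trans hi1)
      rw [ih L₁ (j :: i :: M) hr1 (by rw [a3, a4]) (by rw [a3, e1]) hk,
        ih L₂ (i :: j :: M) hr2 (by rw [b3, b4]) (by rw [b3, e2]) hk']
      simp only [List.map_cons, List.prod_cons, ← mul_assoc, gen_braid hd]

theorem wordProd_reducedWord (w : Equiv.Perm (Fin n)) : wordProd (reducedWord w) = w :=
  (exists_reduced_word w).choose_spec.1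

theorem length_reducedWord (w : Equiv.Perm (Fin n)) : (reducedWord w).length = len w :=
  (exists_reduced_word w).choose_spec.2

theorem Tw_one : Tw (1 : Equiv.Perm (Fin n)) = 1 := by
  have := length_reducedWord (1 : Equiv.Perm (Fin n))
  rw [len_one, List.length_eq_zero_iff] at this
  simp [Tw, this]

theorem Tw_simple_mul {w : Equiv.Perm (Fin n)} {j : Fin (n - 1)}
    (h : w⁻¹ (lo j) < w⁻¹ (hi j)) : Tw (simple j * w) = gen j * Tw w := by
  have e : wordProd (j :: reducedWord w) = simple j * w := by
    rw [wordProd_cons, wordProd_reducedWord]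
  have := prod_gen_eq_of_reduced (reducedWord (simple j * w)) (j :: reducedWord w)
    (by rw [wordProd_reducedWord, length_reducedWord])
    (by rw [e, List.length_cons, length_reducedWord, len_simple_mul h])
    (by rw [wordProd_reducedWord, e])
  simpa [Tw] using this

theorem Tw_mul_simple {w : Equiv.Perm (Fin n)} {j : Fin (n - 1)}
    (h : w (lo j) < w (hi j)) : Tw (w * simple j) = Tw w * gen j := by
  have e : wordProd (reducedWord w ++ [j]) = w * simple j := by
    rw [wordProd_append, wordProd_cons, wordProd_reducedWord, wordProd_nil, mul_one]
  have := prod_gen_eq_of_reduced (reducedWord (w * simple j)) (reducedWord w ++ [j])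
    (by rw [wordProd_reducedWord, length_reducedWord])
    (by rw [e, List.length_append, length_reducedWord, len_mul_simple h, List.length_singleton])
    (by rw [wordProd_reducedWord, e])
  simpa [Tw] using this

theorem Tw_simple (j : Fin (n - 1)) : Tw (simple j) = gen j := by
  simpa [Tw_one] using Tw_mul_simple (w := 1) (j := j) (lo_lt_hi j)

theorem Tw_mul_gen_of_gt {w : Equiv.Perm (Fin n)} {j : Fin (n - 1)}
    (h : w (hi j) < w (lo j)) :
    Tw w * gen j = (tpow 1 - 1) • Tw w + tpow 1 • Tw (w * simple j) := by
  have h' : (w * simple j) (lo j) < (w * simple j) (hi j) := by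
    simpa [simple_lo, simple_hi] using h
  have := Tw_mul_simple h'
  rw [mul_simple_simple] at this
  rw [this, mul_assoc, gen_mul_self, mul_add, mul_smul_comm, mul_smul_comm, mul_one]

/-! ### Stabilizers of dominant weights -/

theorem permAct_one (μ : Fin n → ℤ) : permAct 1 μ = μ := rfl

theorem permAct_mul (v w : Equiv.Perm (Fin n)) (μ : Fin n → ℤ) :
    permAct (v * w) μ = permAct v (permAct w μ) := by
  funext i; simp [permAct]

theorem permAct_apply (w : Equiv.Perm (Fin n)) (μ : Fin n → ℤ) (i : Fin n) :
    permAct w μ i = μ (w⁻¹ i) := rfl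

theorem mem_stab {μ : Fin n → ℤ} {w : Equiv.Perm (Fin n)} : w ∈ stab μ ↔ permAct w μ = μ := by
  simp [stab]

theorem mem_stab' {μ : Fin n → ℤ} {w : Equiv.Perm (Fin n)} : w ∈ stab μ ↔ ∀ i, μ (w i) = μ i := by
  rw [mem_stab]
  constructor
  · intro h i
    conv_lhs => rw [← h]
    simp [permAct]
  · intro h
    funext i
    rw [permAct_apply, ← h]
    simp

theorem one_mem_stab (μ : Fin n → ℤ) : 1 ∈ stab μ := mem_stab.2 (permAct_one μ)

theorem mul_mem_stab {μ : Fin n → ℤ} {v w : Equiv.Perm (Fin n)} (hv : v ∈ stab μ)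
    (hw : w ∈ stab μ) : v * w ∈ stab μ := by
  rw [mem_stab] at *
  rw [permAct_mul, hw, hv]

theorem inv_mem_stab {μ : Fin n → ℤ} {v : Equiv.Perm (Fin n)} (hv : v ∈ stab μ) :
    v⁻¹ ∈ stab μ := by
  rw [mem_stab] at *
  conv_lhs => rw [← hv]
  rw [← permAct_mul, inv_mul_cancel, permAct_one]

theorem simple_mem_stab {μ : Fin n → ℤ} {j : Fin (n - 1)} :
    simple j ∈ stab μ ↔ μ (lo j) = μ (hi j) := by
  rw [mem_stab']
  constructor
  · intro h
    rw [← h (lo j), simple_lo]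
  · intro h i
    by_cases h1 : i = lo j
    · rw [h1, simple_lo, h]
    by_cases h2 : i = hi j
    · rw [h2, simple_hi, h]
    rw [simple_apply_of_ne h1 h2]

/-- A descent of an element of the stabilizer of a dominant weight lies in the stabilizer. -/
theorem simple_mem_stab_of_descent {μ : Fin n → ℤ} (hμ : Antitone μ) {v : Equiv.Perm (Fin n)}
    (hv : v ∈ stab μ) {j : Fin (n - 1)} (hj : v (hi j) < v (lo j)) : simple j ∈ stab μ := by
  rw [simple_mem_stab]
  refine le_antisymm ?_ (hμ (lo_lt_hi j).le)
  rw [mem_stab'] at hv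
  rw [← hv (lo j), ← hv (hi j)]
  exact hμ hj.le

/-- Induction on the stabilizer of a dominant weight by right multiplication. -/
theorem stab_induction {μ : Fin n → ℤ} (hμ : Antitone μ) {P : Equiv.Perm (Fin n) → Prop}
    (one : P 1)
    (step : ∀ v ∈ stab μ, ∀ j, simple j ∈ stab μ → v (lo j) < v (hi j) → P v → P (v * simple j))
    {v : Equiv.Perm (Fin n)} (hv : v ∈ stab μ) : P v := by
  induction hk : len v using Nat.strong_induction_on generalizing v with
  | _ k ih =>
    by_cases h1 : v = 1
    · rw [h1]; exact one
    obtain ⟨j, hj⟩ := exists_descent h1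
    have hs := simple_mem_stab_of_descent hμ hv hj
    have hl := len_mul_simple_of_gt hj
    have := step (v * simple j) (mul_mem_stab hv hs) j hs
      (by simpa [simple_lo, simple_hi] using hj) (ih _ (by omega) (mul_mem_stab hv hs) rfl)
    rwa [mul_simple_simple] at this

/-- `w` is the shortest element of its coset modulo the stabilizer of the dominant weight `μ`. -/
def IsMinRep (μ : Fin n → ℤ) (w : Equiv.Perm (Fin n)) : Prop :=
  ∀ p q, p < q → μ p = μ q → w p < w q

theorem IsMinRep.mul_lo_lt {μ : Fin n → ℤ} {u v : Equiv.Perm (Fin n)} (hu : IsMinRep μ u)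
    (hv : v ∈ stab μ) {j : Fin (n - 1)} (hs : simple j ∈ stab μ) (hj : v (lo j) < v (hi j)) :
    (u * v) (lo j) < (u * v) (hi j) := by
  refine hu _ _ hj ?_
  rw [mem_stab'] at hv
  rw [hv, hv, simple_mem_stab.1 hs]

/-- Building v by ascents inside the stabilizer, each ascent of v is an ascent of u v, because u
preserves order where μ is constant. -/
theorem IsMinRep.Tw_mul {μ : Fin n → ℤ} (hμ : Antitone μ) {u v : Equiv.Perm (Fin n)}
    (hu : IsMinRep μ u) (hv : v ∈ stab μ) : Tw (u * v) = Tw u * Tw v := by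
  refine stab_induction hμ (P := fun v => Tw (u * v) = Tw u * Tw v) ?_ ?_ hv
  · simp [Tw_one]
  · intro v hv j hs hj ih
    rw [← mul_assoc, Tw_mul_simple (hu.mul_lo_lt hv hs hj), Tw_mul_simple hj, ih, mul_assoc]

theorem IsMinRep.len_mul {μ : Fin n → ℤ} (hμ : Antitone μ) {u v : Equiv.Perm (Fin n)}
    (hu : IsMinRep μ u) (hv : v ∈ stab μ) : len (u * v) = len u + len v := by
  refine stab_induction hμ (P := fun v => len (u * v) = len u + len v) ?_ ?_ hv
  · simp [len_one]
  · intro v hv j hs hj ih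
    rw [← mul_assoc, len_mul_simple (hu.mul_lo_lt hv hs hj), len_mul_simple hj, ih, add_assoc]

/-- The mirror image of `IsMinRep.Tw_mul`, needed because `colElt` is built from the inverse of u_C.
-/
theorem IsMinRep.Tw_inv_mul {μ : Fin n → ℤ} (hμ : Antitone μ) {u v : Equiv.Perm (Fin n)}
    (hu : IsMinRep μ u) (hv : v ∈ stab μ) : Tw (v⁻¹ * u⁻¹) = Tw v⁻¹ * Tw u⁻¹ := by
  refine stab_induction hμ (P := fun v => Tw (v⁻¹ * u⁻¹) = Tw v⁻¹ * Tw u⁻¹) ?_ ?_ hv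
  · simp [Tw_one]
  · intro v hv j hs hj ih
    have h1 := hu.mul_lo_lt hv hs hj
    rw [mul_inv_rev, simple_inv, mul_assoc, Tw_simple_mul (by simpa using h1),
      Tw_simple_mul (by simpa using hj), ih, mul_assoc]

theorem eq_one_of_isMinRep {μ : Fin n → ℤ} (hμ : Antitone μ) {u v : Equiv.Perm (Fin n)}
    (hu : IsMinRep μ u) (hv : v ∈ stab μ) (huv : IsMinRep μ (u * v)) : v = 1 := by
  by_contra h1
  obtain ⟨j, hj⟩ := exists_descent h1
  have hs := simple_mem_stab.1 (simple_mem_stab_of_descent hμ hv hj)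
  have h2 := huv _ _ (lo_lt_hi j) hs
  rw [mem_stab'] at hv
  exact absurd h2 (not_lt.2 (hu _ _ hj (by rw [hv, hv, hs])).le)

/-- Identifies u_C for a transformed column without computing with its explicit definition. -/
theorem IsMinRep.ext {μ : Fin n → ℤ} (hμ : Antitone μ) {u w : Equiv.Perm (Fin n)}
    (hu : IsMinRep μ u) (hw : IsMinRep μ w) (h : permAct u μ = permAct w μ) : u = w := by
  have := eq_one_of_isMinRep hμ hu (v := u⁻¹ * w)
    (by rw [mem_stab, permAct_mul, ← h, ← permAct_mul, inv_mul_cancel, permAct_one])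
    (by simpa using hw)
  rw [inv_mul_eq_one] at this
  exact this

/-- Induction on shortest coset representatives by left multiplication. -/
theorem IsMinRep.induction {μ : Fin n → ℤ} (hμ : Antitone μ) {P : Equiv.Perm (Fin n) → Prop}
    (one : P 1)
    (step : ∀ w, IsMinRep μ w → ∀ j, w⁻¹ (lo j) < w⁻¹ (hi j) →
      permAct w μ (hi j) < permAct w μ (lo j) → P w → P (simple j * w))
    {w : Equiv.Perm (Fin n)} (hw : IsMinRep μ w) : P w := by
  induction hk : len w using Nat.strong_induction_on generalizing w with
  | _ k ih =>
    by_cases h1 : w = 1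
    · rw [h1]; exact one
    obtain ⟨j, hj⟩ := exists_descent (w := w⁻¹) (by simpa using h1)
    have hl := len_simple_mul_of_gt hj
    -- Only the pair of positions that w sends to `lo j` and `hi j` could change order, and w
    -- already has this pair reversed.
    have hm : IsMinRep μ (simple j * w) := by
      intro p q hpq hμpq
      refine simple_lt_simple j (hw p q hpq hμpq) ?_
      rintro ⟨h2, h3⟩
      rw [← h2, ← h3] at hj
      exact lt_asymm (by simpa using hj) hpq
    have := step (simple j * w) hm j (by simpa [simple_inv, simple_lo, simple_hi] using hj)
      (by
        simp only [permAct_apply, mul_inv_rev, simple_inv, Equiv.Perm.mul_apply, simple_lo,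
          simple_hi]
        -- Equal values of μ at these two positions would force w to keep them in order, against the
        -- descent.
        refine lt_of_le_of_ne (hμ hj.le) fun h2 => ?_
        have := hw _ _ hj h2.symm
        exact lt_asymm (lo_lt_hi j) (by simpa using this))
      (ih _ (by omega) hm rfl)
    rwa [simple_mul_simple] at this

/-! ### Powers of t, homomorphisms out of H_n, and the character T_i ↦ t. -/

theorem tpow_zero : tpow 0 = 1 := LaurentPolynomial.T_zero

theorem tpow_add (a b : ℕ) : tpow (a + b) = tpow a * tpow b := by
  rw [tpow, Nat.cast_add, LaurentPolynomial.T_add, tpow, tpow]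

theorem isUnit_tpow (k : ℕ) : IsUnit (tpow k) := LaurentPolynomial.isUnit_T _

/-- An algebra homomorphism out of the Hecke algebra, given by images of the generators. -/
def heckeLift {B : Type*} [Ring B] [Algebra ℤ[T;T⁻¹] B] (f : Fin (n - 1) → B)
    (quad : ∀ i, f i * f i = (tpow 1 - 1) • f i + tpow 1 • (1 : B))
    (braid : ∀ i j : Fin (n - 1), j.val = i.val + 1 → f i * f j * f i = f j * f i * f j)
    (comm : ∀ i j : Fin (n - 1), i.val + 1 < j.val → f i * f j = f j * f i) :
    Hecke n →ₐ[ℤ[T;T⁻¹]] B :=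
  RingQuot.liftAlgHom ℤ[T;T⁻¹] ⟨FreeAlgebra.lift ℤ[T;T⁻¹] f, by
    intro x y h
    cases h with
    | quad i => simpa using quad i
    | braid i j h => simpa using braid i j h
    | comm i j h => simpa using comm i j h⟩

theorem heckeLift_gen {B : Type*} [Ring B] [Algebra ℤ[T;T⁻¹] B] (f : Fin (n - 1) → B)
    (quad braid comm) (i : Fin (n - 1)) : heckeLift f quad braid comm (gen i) = f i := by
  simp [heckeLift, gen]

/-- The character `T_i ↦ t` of the Hecke algebra. -/
def character (n : ℕ) : Hecke n →ₐ[ℤ[T;T⁻¹]] ℤ[T;T⁻¹] :=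
  heckeLift (fun _ => tpow 1) (fun _ => by simp only [smul_eq_mul]; ring) (fun _ _ _ => rfl)
    (fun _ _ _ => rfl)

theorem character_gen (i : Fin (n - 1)) : character n (gen i) = tpow 1 := heckeLift_gen _ _ _ _ _

theorem character_Tw (w : Equiv.Perm (Fin n)) : character n (Tw w) = tpow (len w) := by
  rw [Tw, ← length_reducedWord, map_list_prod, List.map_map]
  induction reducedWord w with
  | nil => simp [tpow_zero]
  | cons i L ih =>
    rw [List.map_cons, List.prod_cons, ih, List.length_cons, add_comm, tpow_add]
    simp [character_gen]

/-! ### The representation on functions on weights -/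

/-- The action of `T` for the transposition of the positions `p` and `q`. -/
def opFun (p q : Fin n) (f : (Fin n → ℤ) → ℤ[T;T⁻¹]) (μ : Fin n → ℤ) : ℤ[T;T⁻¹] :=
  if μ p = μ q then tpow 1 * f μ
  else if μ q < μ p then tpow 1 * f (μ ∘ Equiv.swap p q)
  else f (μ ∘ Equiv.swap p q) + (tpow 1 - 1) * f μ

/-- The linear map underlying `opFun`. -/
def op (p q : Fin n) : Module.End ℤ[T;T⁻¹] ((Fin n → ℤ) → ℤ[T;T⁻¹]) where
  toFun := opFun p q
  map_add' f g := by
    funext μ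
    simp only [opFun, Pi.add_apply]
    split_ifs <;> ring
  map_smul' c f := by
    funext μ
    simp only [opFun, Pi.smul_apply, smul_eq_mul, RingHom.id_apply]
    split_ifs <;> ring

theorem op_apply (p q : Fin n) (f : (Fin n → ℤ) → ℤ[T;T⁻¹]) (μ : Fin n → ℤ) :
    op p q f μ = if μ p = μ q then tpow 1 * f μ
      else if μ q < μ p then tpow 1 * f (μ ∘ Equiv.swap p q)
      else f (μ ∘ Equiv.swap p q) + (tpow 1 - 1) * f μ := rfl

theorem op_quad (p q : Fin n) :
    op p q * op p q = (tpow 1 - 1) • op p q + tpow 1 • 1 := by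
  ext f μ : 2
  have hs : (μ ∘ Equiv.swap p q) ∘ Equiv.swap p q = μ := by
    funext i; simp
  simp only [Module.End.mul_apply, op_apply, LinearMap.add_apply, LinearMap.smul_apply,
    Pi.add_apply, Pi.smul_apply, smul_eq_mul, Module.End.one_apply, hs, Function.comp_apply,
    Equiv.swap_apply_left, Equiv.swap_apply_right]
  rcases lt_trichotomy (μ p) (μ q) with h | h | h
  · simp only [h, h.ne, h.ne', h.not_gt, if_true, if_false]; ring
  · simp only [h, if_true]; ring
  · simp only [h, h.ne, h.ne', h.not_gt, if_true, if_false]; ring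

/-- The weight `μ` with its values at three positions replaced. -/
def withValues (μ : Fin n → ℤ) (p q r : Fin n) (x y z : ℤ) : Fin n → ℤ :=
  fun i => if i = p then x else if i = q then y else if i = r then z else μ i

theorem withValues_self (μ : Fin n → ℤ) (p q r : Fin n) :
    withValues μ p q r (μ p) (μ q) (μ r) = μ := by
  funext i
  simp only [withValues]
  split_ifs with h1 h2 h3 <;> simp_all

theorem op_left_withValues {p q r : Fin n} (hpq : p ≠ q)
    (f : (Fin n → ℤ) → ℤ[T;T⁻¹]) (μ : Fin n → ℤ) (x y z : ℤ) :
    op p q f (withValues μ p q r x y z) =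
      if x = y then tpow 1 * f (withValues μ p q r x y z)
      else if y < x then tpow 1 * f (withValues μ p q r y x z)
      else f (withValues μ p q r y x z) + (tpow 1 - 1) * f (withValues μ p q r x y z) := by
  have h : withValues μ p q r x y z ∘ Equiv.swap p q = withValues μ p q r y x z := by
    funext i
    simp only [withValues, Function.comp_apply, Equiv.swap_apply_def]
    split_ifs <;> simp_all
  rw [op_apply, h]
  simp [withValues, hpq.symm]

theorem op_right_withValues {p q r : Fin n} (hpq : p ≠ q) (hpr : p ≠ r) (hqr : q ≠ r)
    (f : (Fin n → ℤ) → ℤ[T;T⁻¹]) (μ : Fin n → ℤ) (x y z : ℤ) :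
    op q r f (withValues μ p q r x y z) =
      if y = z then tpow 1 * f (withValues μ p q r x y z)
      else if z < y then tpow 1 * f (withValues μ p q r x z y)
      else f (withValues μ p q r x z y) + (tpow 1 - 1) * f (withValues μ p q r x y z) := by
  have h : withValues μ p q r x y z ∘ Equiv.swap q r = withValues μ p q r x z y := by
    funext i
    simp only [withValues, Function.comp_apply, Equiv.swap_apply_def]
    split_ifs <;> simp_all
  rw [op_apply, h]
  simp [withValues, hpq.symm, hpr.symm, hqr.symm]

/-- The operators involve only the values at three positions, so the relation is a finite check over
the relative orders of three integers. -/
theorem op_braid {p q r : Fin n} (hpq : p ≠ q) (hpr : p ≠ r) (hqr : q ≠ r) :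
    op p q * op q r * op p q = op q r * op p q * op q r := by
  ext f μ : 2
  simp only [Module.End.mul_apply]
  rw [← withValues_self μ p q r]
  generalize μ p = x, μ q = y, μ r = z
  simp only [op_left_withValues hpq, op_right_withValues hpq hpr hqr]
  rcases lt_trichotomy x y with h1 | h1 | h1 <;> rcases lt_trichotomy y z with h2 | h2 | h2 <;>
    rcases lt_trichotomy x z with h3 | h3 | h3 <;> first
    | (exfalso; omega)
    | (subst_vars
       simp only [if_true, if_false, lt_irrefl, *, ne_of_lt, ne_of_gt, not_lt_of_gt]
       try ring)

theorem op_comm {p q r s : Fin n} (hpr : p ≠ r) (hps : p ≠ s) (hqr : q ≠ r) (hqs : q ≠ s) :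
    op p q * op r s = op r s * op p q := by
  ext f μ : 2
  have h : (μ ∘ Equiv.swap p q) ∘ Equiv.swap r s = (μ ∘ Equiv.swap r s) ∘ Equiv.swap p q := by
    funext i
    simp only [Function.comp_apply, Equiv.swap_apply_def]
    split_ifs <;> simp_all
  simp only [Module.End.mul_apply, op_apply, h, Function.comp_apply,
    Equiv.swap_apply_of_ne_of_ne hpr hps, Equiv.swap_apply_of_ne_of_ne hqr hqs,
    Equiv.swap_apply_of_ne_of_ne hpr.symm hqr.symm, Equiv.swap_apply_of_ne_of_ne hps.symm hqs.symm]
  split_ifs <;> ring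

/-- The representation of the Hecke algebra on functions on weights. -/
def rep (n : ℕ) : Hecke n →ₐ[ℤ[T;T⁻¹]] Module.End ℤ[T;T⁻¹] ((Fin n → ℤ) → ℤ[T;T⁻¹]) :=
  heckeLift (fun i => op (lo i) (hi i)) (fun i => op_quad _ _)
    (fun i j h => by
      rw [hi_eq_lo h]
      refine op_braid ?_ ?_ ?_ <;> simp only [lo, hi, ne_eq, Fin.ext_iff] <;> omega)
    (fun i j h => by
      refine op_comm ?_ ?_ ?_ ?_ <;> simp only [lo, hi, ne_eq, Fin.ext_iff] <;> omega)

theorem comp_swap_eq_permAct (μ : Fin n → ℤ) (j : Fin (n - 1)) :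
    μ ∘ Equiv.swap (lo j) (hi j) = permAct (simple j) μ := by
  funext i
  rw [permAct_apply, simple_inv]
  rfl

theorem rep_gen_apply (j : Fin (n - 1)) (f : (Fin n → ℤ) → ℤ[T;T⁻¹]) (μ : Fin n → ℤ) :
    rep n (gen j) f μ = if μ (lo j) = μ (hi j) then tpow 1 * f μ
      else if μ (hi j) < μ (lo j) then tpow 1 * f (permAct (simple j) μ)
      else f (permAct (simple j) μ) + (tpow 1 - 1) * f μ := by
  rw [rep, heckeLift_gen, op_apply, comp_swap_eq_permAct]

/-- The basis vector `e_μ`. -/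
def basisVec (μ : Fin n → ℤ) : (Fin n → ℤ) → ℤ[T;T⁻¹] := Pi.single μ 1

theorem basisVec_apply (μ ν : Fin n → ℤ) : basisVec μ ν = if ν = μ then 1 else 0 := by
  simp [basisVec, Pi.single_apply]

theorem permAct_simple_eq_iff (j : Fin (n - 1)) (μ ν : Fin n → ℤ) :
    permAct (simple j) μ = ν ↔ μ = permAct (simple j) ν := by
  constructor
  · rintro rfl; rw [← permAct_mul, simple_mul_self, permAct_one]
  · rintro rfl; rw [← permAct_mul, simple_mul_self, permAct_one]

theorem permAct_simple_lo (j : Fin (n - 1)) (μ : Fin n → ℤ) :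
    permAct (simple j) μ (lo j) = μ (hi j) := by rw [permAct_apply, simple_inv, simple_lo]

theorem permAct_simple_hi (j : Fin (n - 1)) (μ : Fin n → ℤ) :
    permAct (simple j) μ (hi j) = μ (lo j) := by rw [permAct_apply, simple_inv, simple_hi]

theorem rep_gen_basisVec_of_eq {j : Fin (n - 1)} {μ : Fin n → ℤ} (h : μ (lo j) = μ (hi j)) :
    rep n (gen j) (basisVec μ) = tpow 1 • basisVec μ := by
  have hs := mem_stab.1 (simple_mem_stab.2 h)
  funext ν
  rw [rep_gen_apply, Pi.smul_apply, smul_eq_mul]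
  simp only [basisVec_apply, permAct_simple_eq_iff, hs]
  by_cases hν : ν = μ
  · subst hν; simp [h]
  · simp [hν]

/-- With `rep_gen_basisVec_of_eq`, this makes the orbit of a dominant weight a model of the module
induced from the character of the parabolic subalgebra. -/
theorem rep_gen_basisVec_of_gt {j : Fin (n - 1)} {μ : Fin n → ℤ} (h : μ (hi j) < μ (lo j)) :
    rep n (gen j) (basisVec μ) = basisVec (permAct (simple j) μ) := by
  funext ν
  rw [rep_gen_apply]
  simp only [basisVec_apply, permAct_simple_eq_iff]
  have hne : μ ≠ permAct (simple j) μ := fun he => by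
    have := congrFun he (lo j)
    rw [permAct_simple_lo] at this
    exact h.ne' this
  by_cases h1 : ν = μ
  · subst h1; simp [h, h.ne', hne]
  by_cases h2 : ν = permAct (simple j) μ
  · subst h2; simp [permAct_simple_lo, permAct_simple_hi, h.ne, h.not_gt, hne.symm]
  · simp [h1, h2]

/-- Along a shortest representative every letter meets a strict descent of the current weight, so
the quadratic correction never appears. -/
theorem rep_Tw_basisVec_of_isMinRep {μ : Fin n → ℤ} (hμ : Antitone μ) {w : Equiv.Perm (Fin n)}
    (hw : IsMinRep μ w) : rep n (Tw w) (basisVec μ) = basisVec (permAct w μ) := by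
  refine IsMinRep.induction hμ
    (P := fun w => rep n (Tw w) (basisVec μ) = basisVec (permAct w μ)) ?_ ?_ hw
  · simp [Tw_one, permAct_one]
  · intro w _ j h1 h2 ih
    rw [Tw_simple_mul h1, map_mul, Module.End.mul_apply, ih, rep_gen_basisVec_of_gt h2,
      permAct_mul]

theorem rep_Tw_basisVec_of_mem_stab {μ : Fin n → ℤ} (hμ : Antitone μ) {v : Equiv.Perm (Fin n)}
    (hv : v ∈ stab μ) : rep n (Tw v) (basisVec μ) = tpow (len v) • basisVec μ := by
  refine stab_induction hμ
    (P := fun v => rep n (Tw v) (basisVec μ) = tpow (len v) • basisVec μ) ?_ ?_ hv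
  · simp [Tw_one, len_one, tpow_zero]
  · intro v _ j hs hj ih
    rw [Tw_mul_simple hj, map_mul, Module.End.mul_apply,
      rep_gen_basisVec_of_eq (simple_mem_stab.1 hs), map_smul, ih, len_mul_simple hj, tpow_add,
      smul_smul, mul_comm]

/-! ### The standard basis of the Hecke algebra -/

/-- A regular dominant weight. -/
def regularWeight (n : ℕ) : Fin n → ℤ := fun i => -(i.val : ℤ)

theorem regularWeight_injective : Function.Injective (regularWeight n) := fun p q h => by
  simp only [regularWeight, neg_inj, Nat.cast_inj] at h
  exact Fin.ext h

theorem antitone_regularWeight : Antitone (regularWeight n) := fun p q h => by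
  simp only [regularWeight, neg_le_neg_iff, Nat.cast_le]
  exact h

/-- The coefficient of `T_w` in an element of the Hecke algebra. -/
def coeff (w : Equiv.Perm (Fin n)) : Hecke n →ₗ[ℤ[T;T⁻¹]] ℤ[T;T⁻¹] where
  toFun h := rep n h (basisVec (regularWeight n)) (permAct w (regularWeight n))
  map_add' x y := by simp
  map_smul' c x := by simp

/-- A regular weight has trivial stabilizer, so every permutation is a shortest representative and
the T_w reach distinct basis vectors. This is the linear independence of the T_w. -/
theorem coeff_Tw (u w : Equiv.Perm (Fin n)) : coeff w (Tw u) = if w = u then 1 else 0 := by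
  change rep n (Tw u) (basisVec (regularWeight n)) (permAct w (regularWeight n)) = _
  rw [rep_Tw_basisVec_of_isMinRep antitone_regularWeight, basisVec_apply]
  · congr 1
    simp only [eq_iff_iff]
    refine ⟨fun h => ?_, fun h => by rw [h]⟩
    rw [← inv_inj]
    ext i : 1
    exact regularWeight_injective (congrFun h i)
  · intro p q h1 h2
    exact absurd (regularWeight_injective h2) h1.ne

theorem gen_mem_parabolic {μ : Fin n → ℤ} {j : Fin (n - 1)} (hs : simple j ∈ stab μ) :
    gen j ∈ parabolic μ :=
  Algebra.subset_adjoin ⟨simple j, hs, (Tw_simple j).symm⟩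

theorem Tw_mem_parabolic {μ : Fin n → ℤ} {v : Equiv.Perm (Fin n)} (hv : v ∈ stab μ) :
    Tw v ∈ parabolic μ := Algebra.subset_adjoin ⟨v, hv, rfl⟩

/-- The span of the `T_w` with `w` in the stabilizer of `μ`. -/
def parabolicSpan (μ : Fin n → ℤ) : Submodule ℤ[T;T⁻¹] (Hecke n) :=
  Submodule.span ℤ[T;T⁻¹] (Tw '' (stab μ : Set (Equiv.Perm (Fin n))))

theorem Tw_mem_parabolicSpan {μ : Fin n → ℤ} {v : Equiv.Perm (Fin n)} (hv : v ∈ stab μ) :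
    Tw v ∈ parabolicSpan μ := Submodule.subset_span ⟨v, hv, rfl⟩

theorem mul_gen_mem_parabolicSpan {μ : Fin n → ℤ} {j : Fin (n - 1)} (hs : simple j ∈ stab μ)
    {x : Hecke n} (hx : x ∈ parabolicSpan μ) : x * gen j ∈ parabolicSpan μ := by
  induction hx using Submodule.span_induction with
  | mem x hx =>
    obtain ⟨v, hv, rfl⟩ := hx
    have hv' := mul_mem_stab hv hs
    rcases lt_or_gt_of_ne (apply_lo_ne_apply_hi v j) with h | h
    · rw [← Tw_mul_simple h]
      exact Tw_mem_parabolicSpan hv'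
    · rw [Tw_mul_gen_of_gt h]
      exact add_mem (Submodule.smul_mem _ _ (Tw_mem_parabolicSpan hv))
        (Submodule.smul_mem _ _ (Tw_mem_parabolicSpan hv'))
  | zero => rw [zero_mul]; exact zero_mem _
  | add x y _ _ hx hy => rw [add_mul]; exact add_mem hx hy
  | smul c x _ hx => rw [smul_mul_assoc]; exact Submodule.smul_mem _ _ hx

theorem mul_Tw_mem_parabolicSpan {μ : Fin n → ℤ} (hμ : Antitone μ) {v : Equiv.Perm (Fin n)}
    (hv : v ∈ stab μ) {x : Hecke n} (hx : x ∈ parabolicSpan μ) :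
    x * Tw v ∈ parabolicSpan μ := by
  refine stab_induction hμ (P := fun v => x * Tw v ∈ parabolicSpan μ) ?_ ?_ hv
  · rwa [Tw_one, mul_one]
  · intro v _ j hs hj ih
    rw [Tw_mul_simple hj, ← mul_assoc]
    exact mul_gen_mem_parabolicSpan hs ih

theorem parabolic_le_parabolicSpan {μ : Fin n → ℤ} (hμ : Antitone μ) {x : Hecke n}
    (hx : x ∈ parabolic μ) : x ∈ parabolicSpan μ := by
  induction hx using Algebra.adjoin_induction with
  | mem x hx =>
    obtain ⟨v, hv, rfl⟩ := hx
    exact Tw_mem_parabolicSpan hv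
  | algebraMap r =>
    rw [Algebra.algebraMap_eq_smul_one, ← Tw_one]
    exact Submodule.smul_mem _ _ (Tw_mem_parabolicSpan (one_mem_stab μ))
  | add x y _ _ hx hy => exact add_mem hx hy
  | mul x y _ h hx hy =>
    clear h
    induction hy using Submodule.span_induction with
    | mem y hy =>
      obtain ⟨v, hv, rfl⟩ := hy
      exact mul_Tw_mem_parabolicSpan hμ hv hx
    | zero => rw [mul_zero]; exact zero_mem _
    | add y z _ _ hy hz => rw [mul_add]; exact add_mem hy hz
    | smul c y _ hy => rw [mul_smul_comm]; exact Submodule.smul_mem _ _ hy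

theorem eq_sum_coeff_of_mem_parabolic {μ : Fin n → ℤ} (hμ : Antitone μ) {x : Hecke n}
    (hx : x ∈ parabolic μ) : x = ∑ w ∈ stab μ, coeff w x • Tw w := by
  have hx' := parabolic_le_parabolicSpan hμ hx
  clear hx
  induction hx' using Submodule.span_induction with
  | mem x hx =>
    obtain ⟨v, hv, rfl⟩ := hx
    rw [Finset.mem_coe] at hv
    simp [coeff_Tw, ite_smul, hv]
  | zero => simp
  | add x y _ _ hx hy =>
    conv_lhs => rw [hx, hy]
    simp only [map_add, add_smul, Finset.sum_add_distrib]
  | smul c x _ hx =>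
    conv_lhs => rw [hx]
    simp only [map_smul, smul_assoc, Finset.smul_sum]

theorem stab_zero : stab (0 : Fin n → ℤ) = Finset.univ := by
  ext w; simp [mem_stab']

/-- Makes H_n itself a parabolic subalgebra, so statements about H_{n,μ} specialize to H_n. -/
theorem mem_parabolic_zero (x : Hecke n) : x ∈ parabolic (0 : Fin n → ℤ) := by
  obtain ⟨y, rfl⟩ := RingQuot.mkAlgHom_surjective ℤ[T;T⁻¹] (HeckeRel n) x
  induction y using FreeAlgebra.induction with
  | grade0 r =>
    rw [AlgHom.commutes]
    exact Subalgebra.algebraMap_mem _ r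
  | grade1 i => exact gen_mem_parabolic (by simp [stab_zero])
  | mul a b ha hb => rw [map_mul]; exact mul_mem ha hb
  | add a b ha hb => rw [map_add]; exact add_mem ha hb

theorem eq_sum_coeff (x : Hecke n) : x = ∑ w, coeff w x • Tw w := by
  conv_lhs => rw [eq_sum_coeff_of_mem_parabolic (antitone_const (c := (0 : ℤ)))
    (mem_parabolic_zero x)]
  have : stab (fun _ : Fin n => (0 : ℤ)) = Finset.univ := stab_zero
  rw [this]

theorem rep_basisVec_of_mem_parabolic {μ : Fin n → ℤ} (hμ : Antitone μ) {x : Hecke n}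
    (hx : x ∈ parabolic μ) : rep n x (basisVec μ) = character n x • basisVec μ := by
  induction hx using Algebra.adjoin_induction with
  | mem x hx =>
    obtain ⟨v, hv, rfl⟩ := hx
    rw [rep_Tw_basisVec_of_mem_stab hμ hv, character_Tw]
  | algebraMap r => simp
  | add x y _ _ hx hy => rw [map_add, LinearMap.add_apply, hx, hy, map_add, add_smul]
  | mul x y _ _ hx hy =>
    rw [map_mul, Module.End.mul_apply, hy, map_smul, hx, map_mul, smul_smul, mul_comm]

/-! ### Symmetrizers -/

/-- Groups a sum into pairs under an involution that exchanges `p` and its negation. -/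
theorem sum_eq_sum_filter_add {α M : Type*} [DecidableEq α] [AddCommMonoid M] (s : Finset α)
    (σ : α → α) (p : α → Prop) [DecidablePred p] (hσ : ∀ a, σ (σ a) = a)
    (hs : ∀ a ∈ s, σ a ∈ s) (hp : ∀ a, p (σ a) ↔ ¬ p a) (f : α → M) :
    ∑ a ∈ s, f a = ∑ a ∈ s.filter p, (f a + f (σ a)) := by
  rw [← Finset.sum_filter_add_sum_filter_not s p, Finset.sum_add_distrib]
  congr 1
  refine Finset.sum_nbij' σ σ ?_ ?_ (fun a _ => hσ a) (fun a _ => hσ a) fun a _ => by rw [hσ]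
  · intro a ha
    rw [Finset.mem_filter] at *
    exact ⟨hs a ha.1, (hp a).2 ha.2⟩
  · intro a ha
    rw [Finset.mem_filter] at *
    exact ⟨hs a ha.1, fun h => (hp a).1 h ha.2⟩

theorem hecke_sub_smul (a b : ℤ[T;T⁻¹]) (x : Hecke n) : (a - b) • x = a • x - b • x :=
  sub_smul a b x

theorem one_add_gen_mul_gen (j : Fin (n - 1)) :
    (1 + gen j) * gen j = tpow 1 • (1 + gen j : Hecke n) := by
  rw [add_mul, one_mul, gen_mul_self, hecke_sub_smul, one_smul, smul_add]
  abel

theorem gen_mul_one_add_gen (j : Fin (n - 1)) :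
    gen j * (1 + gen j) = tpow 1 • (1 + gen j : Hecke n) := by
  rw [mul_add, mul_one, gen_mul_self, hecke_sub_smul, one_smul, smul_add]
  abel

/-- Pairing w with w s_j extracts a right factor 1 + T_j, an eigenvector of T_j with eigenvalue t.
-/
theorem symmetrizer_mul_gen {μ : Fin n → ℤ} {j : Fin (n - 1)} (hs : simple j ∈ stab μ) :
    symmetrizer μ * gen j = tpow 1 • symmetrizer μ := by
  have key : symmetrizer μ =
      ∑ w ∈ (stab μ).filter (fun w => w (lo j) < w (hi j)), Tw w * (1 + gen j) := by
    rw [symmetrizer, sum_eq_sum_filter_add (stab μ) (fun w => w * simple j)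
      (fun w => w (lo j) < w (hi j)) (fun w => mul_simple_simple w j)
      (fun w hw => mul_mem_stab hw hs) (fun w => ?_)]
    · refine Finset.sum_congr rfl fun w hw => ?_
      rw [Tw_mul_simple (Finset.mem_filter.1 hw).2, mul_add, mul_one]
    · simp only [Equiv.Perm.mul_apply, simple_lo, simple_hi, not_lt]
      exact (apply_lo_ne_apply_hi w j).symm.le_iff_lt.symm
  rw [key, Finset.sum_mul, Finset.smul_sum]
  refine Finset.sum_congr rfl fun w _ => ?_
  rw [mul_assoc, one_add_gen_mul_gen, mul_smul_comm]

theorem gen_mul_symmetrizer {μ : Fin n → ℤ} {j : Fin (n - 1)} (hs : simple j ∈ stab μ) :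
    gen j * symmetrizer μ = tpow 1 • symmetrizer μ := by
  have key : symmetrizer μ =
      ∑ w ∈ (stab μ).filter (fun w => w⁻¹ (lo j) < w⁻¹ (hi j)), (1 + gen j) * Tw w := by
    rw [symmetrizer, sum_eq_sum_filter_add (stab μ) (fun w => simple j * w)
      (fun w => w⁻¹ (lo j) < w⁻¹ (hi j)) (fun w => simple_mul_simple w j)
      (fun w hw => mul_mem_stab hs hw) (fun w => ?_)]
    · refine Finset.sum_congr rfl fun w hw => ?_
      rw [Tw_simple_mul (Finset.mem_filter.1 hw).2, add_mul, one_mul]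
    · simp only [mul_inv_rev, simple_inv, Equiv.Perm.mul_apply, simple_lo, simple_hi, not_lt]
      exact (apply_lo_ne_apply_hi w⁻¹ j).symm.le_iff_lt.symm
  rw [key, Finset.mul_sum, Finset.smul_sum]
  refine Finset.sum_congr rfl fun w _ => ?_
  rw [← mul_assoc, gen_mul_one_add_gen, smul_mul_assoc]

theorem Tw_mul_symmetrizer {μ : Fin n → ℤ} (hμ : Antitone μ) {v : Equiv.Perm (Fin n)}
    (hv : v ∈ stab μ) : Tw v * symmetrizer μ = tpow (len v) • symmetrizer μ := by
  refine stab_induction hμ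
    (P := fun v => Tw v * symmetrizer μ = tpow (len v) • symmetrizer μ) ?_ ?_ hv
  · simp [Tw_one, len_one, tpow_zero]
  · intro v _ j hs hj ih
    rw [Tw_mul_simple hj, mul_assoc, gen_mul_symmetrizer hs, mul_smul_comm, ih, len_mul_simple hj,
      tpow_add, smul_smul, mul_comm]

theorem mul_symmetrizer_of_mem_parabolic {μ : Fin n → ℤ} (hμ : Antitone μ) {x : Hecke n}
    (hx : x ∈ parabolic μ) : x * symmetrizer μ = character n x • symmetrizer μ := by
  induction hx using Algebra.adjoin_induction with
  | mem x hx =>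
    obtain ⟨v, hv, rfl⟩ := hx
    rw [Tw_mul_symmetrizer hμ hv, character_Tw]
  | algebraMap r => simp [Algebra.algebraMap_eq_smul_one]
  | add x y _ _ hx hy => rw [map_add, add_mul, hx, hy, add_smul]
  | mul x y _ _ hx hy =>
    rw [mul_assoc, hy, mul_smul_comm, hx, map_mul, smul_smul, mul_comm]

theorem character_symmetrizer (μ : Fin n → ℤ) : character n (symmetrizer μ) = poincare μ := by
  simp only [symmetrizer, poincare, map_sum, character_Tw]

theorem symmetrizer_zero : symmetrizer (0 : Fin n → ℤ) = one0 n := by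
  rw [symmetrizer, stab_zero, one0]

theorem mul_one0 (x : Hecke n) : x * one0 n = character n x • one0 n := by
  rw [← symmetrizer_zero]
  exact mul_symmetrizer_of_mem_parabolic (fun _ _ _ => le_rfl) (mem_parabolic_zero x)

theorem poincare_ne_zero (μ : Fin n → ℤ) : poincare μ ≠ 0 := by
  intro h
  -- At t = 1 the Poincaré polynomial counts the stabilizer, which contains the identity.
  have h1 := congrArg (LaurentPolynomial.eval₂ (RingHom.id ℤ) (1 : ℤˣ)) h
  simp [poincare, tpow] at h1
  have := one_mem_stab μ
  rw [h1] at this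
  simp at this

/-! ### Units -/

/-- The quadratic relation reads T_j (T_j + 1 - t) = t, and t is invertible. -/
theorem isUnit_gen (j : Fin (n - 1)) : IsUnit (gen j : Hecke n) := by
  have h1 : gen j * (gen j + (1 - tpow 1) • 1) = tpow 1 • (1 : Hecke n) := by
    rw [mul_add, gen_mul_self, mul_smul_comm, mul_one, hecke_sub_smul, hecke_sub_smul]
    abel
  have h2 : (gen j + (1 - tpow 1) • 1) * gen j = tpow 1 • (1 : Hecke n) := by
    rw [add_mul, gen_mul_self, smul_mul_assoc, one_mul, hecke_sub_smul, hecke_sub_smul]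
    abel
  obtain ⟨u, hu⟩ := isUnit_tpow 1
  rw [← hu] at h1 h2
  have hu' : (↑u⁻¹ : ℤ[T;T⁻¹]) * ↑u = 1 := by simp
  refine isUnit_iff_exists.2 ⟨(↑u⁻¹ : ℤ[T;T⁻¹]) • (gen j + (1 - (↑u : ℤ[T;T⁻¹])) • 1), ?_, ?_⟩
  · rw [mul_smul_comm, h1, smul_smul, hu', one_smul]
  · rw [smul_mul_assoc, h2, smul_smul, hu', one_smul]

theorem isUnit_Tw (w : Equiv.Perm (Fin n)) : IsUnit (Tw w) := by
  rw [Tw]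
  induction reducedWord w with
  | nil => simp
  | cons i L ih =>
    rw [List.map_cons, List.prod_cons]
    exact (isUnit_gen i).mul ih

/-! ### The permutations u_C as shortest coset representatives. -/

theorem antitone_fundWeight (n ℓ : ℕ) : Antitone (fundWeight n ℓ) := by
  intro p q h
  have := Fin.le_def.1 h
  simp only [fundWeight]
  split_ifs <;> omega

theorem fundWeight_eq_iff {ℓ : ℕ} {p q : Fin n} :
    fundWeight n ℓ p = fundWeight n ℓ q ↔ (p.val < ℓ ↔ q.val < ℓ) := by
  by_cases h1 : p.val < ℓ <;> by_cases h2 : q.val < ℓ <;> simp [fundWeight, h1, h2]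

theorem colPerm_apply_of_lt {C : Finset (Fin n)} {i : Fin n} (h : i.val < C.card) :
    colPerm C i = C.orderEmbOfFin rfl ⟨i, h⟩ := by
  have : (finCongr (by rw [Finset.card_add_card_compl, Fintype.card_fin] : n = C.card + Cᶜ.card)) i
      = Fin.castAdd _ ⟨i, h⟩ := rfl
  simp only [colPerm, Equiv.trans_apply, this, finSumFinEquiv_symm_apply_castAdd,
    finSumEquivOfFinset_inl]

theorem colPerm_apply_of_le {C : Finset (Fin n)} {i : Fin n} (h : C.card ≤ i.val) :
    colPerm C i = Cᶜ.orderEmbOfFin rfl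
      ⟨i - C.card, by have := Finset.card_add_card_compl C; rw [Fintype.card_fin] at this; omega⟩ := by
  have : (finCongr (by rw [Finset.card_add_card_compl, Fintype.card_fin] : n = C.card + Cᶜ.card)) i
      = Fin.natAdd C.card ⟨i - C.card, by
        have := Finset.card_add_card_compl C; rw [Fintype.card_fin] at this; omega⟩ := by
    ext
    simp only [finCongr_apply, Fin.val_cast, Fin.natAdd_mk]
    omega
  simp only [colPerm, Equiv.trans_apply, this, finSumFinEquiv_symm_apply_natAdd,
    finSumEquivOfFinset_inr]

theorem colPerm_mem_iff {C : Finset (Fin n)} {i : Fin n} : colPerm C i ∈ C ↔ i.val < C.card := by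
  rcases Nat.lt_or_ge i.val C.card with h | h
  · simp only [h, iff_true]
    rw [colPerm_apply_of_lt h]
    exact Finset.orderEmbOfFin_mem _ _ _
  · simp only [not_lt.2 h, iff_false]
    rw [colPerm_apply_of_le h]
    exact Finset.mem_compl.1 (Finset.orderEmbOfFin_mem _ _ _)

theorem isMinRep_colPerm (C : Finset (Fin n)) : IsMinRep (fundWeight n C.card) (colPerm C) := by
  intro p q hpq h
  rw [fundWeight_eq_iff] at h
  have hlt := Fin.lt_def.1 hpq
  rcases Nat.lt_or_ge q.val C.card with hq | hq
  · rw [colPerm_apply_of_lt hq, colPerm_apply_of_lt (h.2 hq), OrderEmbedding.lt_iff_lt]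
    exact hpq
  · have hp : C.card ≤ p.val := by by_contra hp; exact absurd (h.1 (by omega)) (by omega)
    rw [colPerm_apply_of_le hq, colPerm_apply_of_le hp, OrderEmbedding.lt_iff_lt, Fin.lt_def]
    simp only
    omega

/-- The weight of a column. -/
def colWeight (C : Finset (Fin n)) : Fin n → ℤ := fun i => if i ∈ C then 1 else 0

theorem colWeight_injective : Function.Injective (colWeight (n := n)) := by
  intro C D h
  ext i
  have := congrFun h i
  simp only [colWeight] at this
  split_ifs at this <;> simp_all

theorem mem_permCol {w : Equiv.Perm (Fin n)} {C : Finset (Fin n)} {i : Fin n} :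
    i ∈ permCol w C ↔ w⁻¹ i ∈ C := by
  simp only [permCol, Finset.mem_map_equiv]
  rfl

theorem card_permCol (w : Equiv.Perm (Fin n)) (C : Finset (Fin n)) :
    (permCol w C).card = C.card := Finset.card_map _

theorem permAct_colWeight (w : Equiv.Perm (Fin n)) (C : Finset (Fin n)) :
    permAct w (colWeight C) = colWeight (permCol w C) := by
  funext i
  simp only [permAct_apply, colWeight, mem_permCol]

theorem colWeight_highestCol (n ℓ : ℕ) : colWeight (highestCol n ℓ) = fundWeight n ℓ := by
  funext i
  simp [colWeight, highestCol, fundWeight]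

theorem mem_highestCol {ℓ : ℕ} {i : Fin n} : i ∈ highestCol n ℓ ↔ i.val < ℓ := by
  simp [highestCol]

theorem card_highestCol {ℓ : ℕ} (h : ℓ ≤ n) : (highestCol n ℓ).card = ℓ := by
  rw [highestCol, Fin.card_filter_val_lt, min_eq_right h]

theorem permCol_colPerm (C : Finset (Fin n)) : permCol (colPerm C) (highestCol n C.card) = C := by
  ext i
  rw [mem_permCol, mem_highestCol, ← colPerm_mem_iff]
  simp

theorem permAct_colPerm (C : Finset (Fin n)) :
    permAct (colPerm C) (fundWeight n C.card) = colWeight C := by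
  rw [← colWeight_highestCol, permAct_colWeight, permCol_colPerm]

theorem rep_Tw_colPerm (C : Finset (Fin n)) :
    rep n (Tw (colPerm C)) (basisVec (fundWeight n C.card)) = basisVec (colWeight C) := by
  rw [rep_Tw_basisVec_of_isMinRep (antitone_fundWeight n _) (isMinRep_colPerm C), permAct_colPerm]

theorem mem_stab_fundWeight {ℓ : ℕ} {w : Equiv.Perm (Fin n)} :
    w ∈ stab (fundWeight n ℓ) ↔ permCol w (highestCol n ℓ) = highestCol n ℓ := by
  rw [mem_stab, ← colWeight_highestCol, permAct_colWeight, colWeight_injective.eq_iff]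

theorem permCol_mul (v w : Equiv.Perm (Fin n)) (C : Finset (Fin n)) :
    permCol (v * w) C = permCol v (permCol w C) := by
  ext i; simp [mem_permCol]

/-- Passing from i to w i changes both antitone weights in the same direction, so the changes cannot
cancel in the sum. -/
theorem mem_stab_add {μ ν : Fin n → ℤ} (hμ : Antitone μ) (hν : Antitone ν)
    {w : Equiv.Perm (Fin n)} : w ∈ stab (μ + ν) ↔ w ∈ stab μ ∧ w ∈ stab ν := by
  simp only [mem_stab', Pi.add_apply]
  refine ⟨fun h => ?_, fun h i => by rw [h.1, h.2]⟩
  have key : ∀ i, μ (w i) = μ i ∧ ν (w i) = ν i := by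
    intro i
    have := h i
    rcases le_total i (w i) with h1 | h1 <;>
    · have := hμ h1
      have := hν h1
      constructor <;> linarith
  exact ⟨fun i => (key i).1, fun i => (key i).2⟩

/-- Inductively the smaller letters are fixed. If i came from a later position, monotonicity would
send i to a smaller, already fixed letter, against injectivity. -/
theorem colPerm_apply_eq_self {a : ℕ} {F : Finset (Fin n)} (hF : highestCol n a ⊆ F) {i : Fin n}
    (hi : i.val < a) : colPerm F i = i := by
  induction hk : i.val using Nat.strong_induction_on generalizing i with
  | _ k ih =>
    subst hk
    have hiF : i ∈ F := hF (mem_highestCol.2 hi)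
    obtain ⟨m, hm⟩ := (colPerm F).surjective i
    have hmF : m.val < F.card := colPerm_mem_iff.1 (by rw [hm]; exact hiF)
    rcases lt_trichotomy m i with h | h | h
    · have := ih m.val h (lt_trans h hi) rfl
      rw [hm] at this
      exact absurd this h.ne'
    · rwa [h] at hm
    · have hiF' : i.val < F.card := lt_trans h hmF
      have h1 := isMinRep_colPerm F i m h (fundWeight_eq_iff.2 (iff_of_true hiF' hmF))
      rw [hm] at h1
      have h2 := ih _ h1 (lt_trans h1 hi) rfl
      exact (colPerm F).injective h2

/-- Decomposition of the stabilizer of `ν` into cosets of the stabilizer of `ν + ϖ_b`. -/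
theorem sum_stab_eq {M : Type*} [AddCommMonoid M] {ν : Fin n → ℤ} {a b : ℕ} (hν : Antitone ν)
    (hpos : ∀ i : Fin n, i.val < a → 0 < ν i) (hzero : ∀ i : Fin n, a ≤ i.val → ν i = 0)
    (hab : a ≤ b) (hbn : b ≤ n) (f : Equiv.Perm (Fin n) → M) :
    ∑ w ∈ stab ν, f w =
      ∑ F ∈ (Finset.powersetCard b Finset.univ).filter (fun F => highestCol n a ⊆ F),
        ∑ v ∈ stab (ν + fundWeight n b), f (colPerm F * v) := by
  -- The cosets are the fibres of w ↦ w{1, …, b}. The image contains {1, …, a} because w preserves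
  -- the support of ν.
  rw [← Finset.sum_fiberwise_of_maps_to (g := fun w => permCol w (highestCol n b))
    (t := (Finset.powersetCard b Finset.univ).filter (fun F => highestCol n a ⊆ F))]
  · refine Finset.sum_congr rfl fun F hF => ?_
    rw [Finset.mem_filter, Finset.mem_powersetCard_univ] at hF
    obtain ⟨hFb, hFa⟩ := hF
    subst hFb
    have hu : colPerm F ∈ stab ν := by
      rw [mem_stab']
      intro i
      rcases Nat.lt_or_ge i.val a with hi | hi
      · rw [colPerm_apply_eq_self hFa hi]
      · rw [hzero i hi, hzero]
        by_contra h
        have h1 := colPerm_apply_eq_self hFa (i := colPerm F i) (by omega)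
        have h2 := (colPerm F).injective h1
        rw [h2] at h
        exact h hi
    refine Finset.sum_nbij' (fun w => (colPerm F)⁻¹ * w) (fun v => colPerm F * v) ?_ ?_ ?_ ?_ ?_
    · intro w hw
      rw [Finset.mem_filter] at hw
      rw [mem_stab_add hν (antitone_fundWeight n _)]
      refine ⟨mul_mem_stab (inv_mem_stab hu) hw.1, ?_⟩
      rw [mem_stab_fundWeight, permCol_mul, hw.2]
      conv_lhs => rw [← permCol_colPerm F]
      rw [← permCol_mul, permCol_colPerm F, inv_mul_cancel]
      ext i; simp [mem_permCol]
    · intro v hv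
      rw [mem_stab_add hν (antitone_fundWeight n _)] at hv
      rw [Finset.mem_filter]
      refine ⟨mul_mem_stab hu hv.1, ?_⟩
      rw [permCol_mul, mem_stab_fundWeight.1 hv.2, permCol_colPerm]
    · intro w _; simp
    · intro v _; simp
    · intro w _; simp
  · intro w hw
    rw [Finset.mem_filter, Finset.mem_powersetCard_univ, card_permCol, card_highestCol hbn]
    refine ⟨rfl, fun i hi => ?_⟩
    rw [mem_highestCol] at hi
    rw [mem_permCol, mem_highestCol]
    by_contra h
    have h1 := mem_stab'.1 (inv_mem_stab hw) i
    rw [hzero _ (by omega)] at h1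
    exact absurd (hpos i hi) (by omega)

/-! ### Parabolic expansions -/

theorem exists_isParabolicExpansion {b : ℕ} (hb : b ≤ n) (h : Hecke n) :
    ∃ c, IsParabolicExpansion b h c := by
  refine ⟨fun F => ∑ v ∈ stab (fundWeight n b), coeff (colPerm F * v) h • Tw v, ?_, ?_⟩
  · intro F _
    exact sum_mem fun v hv => Subalgebra.smul_mem _ (Tw_mem_parabolic hv) _
  -- With ν = 0 and a = 0 the coset decomposition runs over all of S_n and all columns of length b.
  · conv_lhs => rw [eq_sum_coeff h, ← stab_zero, sum_stab_eq (ν := 0) (a := 0) (b := b)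
      (fun _ _ _ => le_rfl) (by simp) (by simp) (Nat.zero_le _) hb]
    have e' : (0 : Fin n → ℤ) + fundWeight n b = fundWeight n b := zero_add _
    refine Finset.sum_congr ?_ fun F hF => ?_
    · rw [Finset.filter_true_of_mem]
      intro F _ i hi
      simp [mem_highestCol] at hi
    · rw [Finset.mem_powersetCard_univ] at hF
      subst hF
      rw [Finset.mul_sum, e']
      refine Finset.sum_congr rfl fun v hv => ?_
      rw [(isMinRep_colPerm F).Tw_mul (antitone_fundWeight n _) hv, mul_smul_comm]

theorem isParabolicExpansion_parabolicCoeff {b : ℕ} (hb : b ≤ n) (h : Hecke n) :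
    IsParabolicExpansion b h (parabolicCoeff b h) :=
  Classical.epsilon_spec (exists_isParabolicExpansion hb h)

/-- Since T_{u_C} T_v = T_{u_C v} and the products u_C v are pairwise distinct, the standard basis
determines each coefficient; uniqueness follows. -/
theorem IsParabolicExpansion.coeff_eq {b : ℕ} {h : Hecke n} {c : Finset (Fin n) → Hecke n}
    (hc : IsParabolicExpansion b h c) {F : Finset (Fin n)} (hF : F.card = b)
    {v : Equiv.Perm (Fin n)} (hv : v ∈ stab (fundWeight n b)) :
    coeff v (c F) = coeff (colPerm F * v) h := by
  rw [hc.2, map_sum, Finset.sum_eq_single F]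
  · conv_rhs => rw [eq_sum_coeff_of_mem_parabolic (antitone_fundWeight n b)
      (hc.1 F (by rwa [Finset.mem_powersetCard_univ])), Finset.mul_sum]
    rw [map_sum, Finset.sum_eq_single v]
    · subst hF
      rw [mul_smul_comm, ← (isMinRep_colPerm F).Tw_mul (antitone_fundWeight n _) hv, map_smul,
        coeff_Tw]
      simp
    · intro w hw hwv
      subst hF
      rw [mul_smul_comm, ← (isMinRep_colPerm F).Tw_mul (antitone_fundWeight n _) hw, map_smul,
        coeff_Tw, if_neg (by simpa using hwv.symm), smul_zero]
    · intro h; exact absurd hv h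
  · intro C hC hCF
    rw [eq_sum_coeff_of_mem_parabolic (antitone_fundWeight n b) (hc.1 C hC), Finset.mul_sum,
      map_sum]
    refine Finset.sum_eq_zero fun w hw => ?_
    rw [Finset.mem_powersetCard_univ] at hC
    subst hC
    rw [mul_smul_comm, ← (isMinRep_colPerm C).Tw_mul (antitone_fundWeight n _) hw, map_smul,
      coeff_Tw, if_neg, smul_zero]
    intro he
    have := congrArg (fun w => permCol w (highestCol n C.card)) he
    simp only [permCol_mul, mem_stab_fundWeight.1 hv, mem_stab_fundWeight.1 hw,
      permCol_colPerm] at this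
    rw [← hF, permCol_colPerm] at this
    exact hCF this.symm
  · intro h
    exact absurd (by rwa [Finset.mem_powersetCard_univ]) h

theorem IsParabolicExpansion.unique {b : ℕ} {h : Hecke n} {c c' : Finset (Fin n) → Hecke n}
    (hc : IsParabolicExpansion b h c) (hc' : IsParabolicExpansion b h c') {F : Finset (Fin n)}
    (hF : F.card = b) : c F = c' F := by
  have hF' : F ∈ Finset.powersetCard b Finset.univ := by rwa [Finset.mem_powersetCard_univ]
  rw [eq_sum_coeff_of_mem_parabolic (antitone_fundWeight n b) (hc.1 F hF'),
    eq_sum_coeff_of_mem_parabolic (antitone_fundWeight n b) (hc'.1 F hF')]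
  refine Finset.sum_congr rfl fun v hv => ?_
  rw [hc.coeff_eq hF hv, hc'.coeff_eq hF hv]

/-- Each h_C acts on e_{ϖ_b} by its character, and T_{u_C} then moves e_{ϖ_b} to e_C; evaluation at
the weight of F isolates one term. -/
theorem IsParabolicExpansion.rep_apply {b : ℕ} {h : Hecke n} {c : Finset (Fin n) → Hecke n}
    (hc : IsParabolicExpansion b h c) {F : Finset (Fin n)} (hF : F.card = b) :
    rep n h (basisVec (fundWeight n b)) (colWeight F) = character n (c F) := by
  have key : ∀ C ∈ Finset.powersetCard b Finset.univ,
      rep n (Tw (colPerm C) * c C) (basisVec (fundWeight n b)) (colWeight F) =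
        if F = C then character n (c C) else 0 := by
    intro C hC
    rw [map_mul, Module.End.mul_apply,
      rep_basisVec_of_mem_parabolic (antitone_fundWeight n b) (hc.1 C hC), map_smul]
    rw [Finset.mem_powersetCard_univ] at hC
    subst hC
    rw [rep_Tw_colPerm, Pi.smul_apply, basisVec_apply, smul_eq_mul]
    simp [colWeight_injective.eq_iff]
  conv_lhs => rw [hc.2, map_sum]
  rw [LinearMap.sum_apply, Finset.sum_apply, Finset.sum_congr rfl key]
  simp [hF]

/-! ### The elements `Ψ_T` and the scalars `ψ̃_T` -/

theorem character_colElt (C : Finset (Fin n)) : character n (colElt C) = 1 := by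
  have h1 := Ring.inverse_mul_cancel _ (isUnit_Tw (colPerm C)⁻¹)
  have h2 := congrArg (character n) h1
  rw [map_mul, map_one, character_Tw, len_inv] at h2
  rw [colElt, map_smul, smul_eq_mul, mul_comm, h2]

theorem card_le_n (C : Finset (Fin n)) : C.card ≤ n := by
  simpa using Finset.card_le_univ C

theorem Psi_singleton (C : Finset (Fin n)) :
    Psi [C] = colElt C * symmetrizer (fundWeight n C.card) := by
  rw [Psi]

theorem Psi_cons_cons (C D : Finset (Fin n)) (S : List (Finset (Fin n))) :
    Psi (C :: D :: S) = colElt C * parabolicCoeff C.card (Psi (D :: S)) C := by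
  rw [Psi]

theorem character_Psi_singleton (C : Finset (Fin n)) :
    character n (Psi [C]) = poincare (fundWeight n C.card) := by
  rw [Psi_singleton, map_mul, character_colElt, one_mul, character_symmetrizer]

theorem character_Psi_cons_cons (C D : Finset (Fin n)) (S : List (Finset (Fin n))) :
    character n (Psi (C :: D :: S)) =
      rep n (Psi (D :: S)) (basisVec (fundWeight n C.card)) (colWeight C) := by
  rw [Psi_cons_cons, map_mul, character_colElt, one_mul,
    (isParabolicExpansion_parabolicCoeff (card_le_n C) _).rep_apply rfl]

theorem character_Psi_nil : character n (Psi []) = poincare (0 : Fin n → ℤ) := by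
  rw [Psi, ← symmetrizer_zero, character_symmetrizer]

/-- The character extended to K ⊗ H_n takes the nonzero value W_0 here. This makes ψ̃_T unique. -/
theorem extend_one0_ne_zero : extend (one0 n) ≠ 0 := by
  intro h
  have h1 := congrArg (Algebra.TensorProduct.lift (Algebra.ofId K K)
    ((Algebra.ofId ℤ[T;T⁻¹] K).comp (character n)) fun _ _ => Commute.all _ _) h
  rw [extend, Algebra.TensorProduct.includeRight_apply, Algebra.TensorProduct.lift_tmul, map_one,
    one_mul, map_zero, AlgHom.comp_apply, ← symmetrizer_zero, character_symmetrizer,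
    Algebra.ofId_apply] at h1
  exact poincare_ne_zero _ ((FaithfulSMul.algebraMap_eq_zero_iff ℤ[T;T⁻¹] K).1 h1)

theorem isPsiTilde_iff (T : List (Finset (Fin n))) (c : K) :
    IsPsiTilde T c ↔ c = (algebraMap ℤ[T;T⁻¹] K (poincare (shape T)))⁻¹ *
      algebraMap ℤ[T;T⁻¹] K (character n (Psi T)) := by
  rw [IsPsiTilde, mul_one0, map_smul, ← algebraMap_smul K (character n (Psi T)) (extend (one0 n)),
    smul_smul]
  exact (smul_left_injective K extend_one0_ne_zero).eq_iff

theorem psiTilde_eq (T : List (Finset (Fin n))) :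
    psiTilde T = (algebraMap ℤ[T;T⁻¹] K (poincare (shape T)))⁻¹ *
      algebraMap ℤ[T;T⁻¹] K (character n (Psi T)) :=
  (isPsiTilde_iff T _).1 (Classical.epsilon_spec ⟨_, (isPsiTilde_iff T _).2 rfl⟩)

theorem algebraMap_poincare_ne_zero (μ : Fin n → ℤ) :
    algebraMap ℤ[T;T⁻¹] K (poincare μ) ≠ 0 := fun h =>
  poincare_ne_zero μ ((FaithfulSMul.algebraMap_eq_zero_iff ℤ[T;T⁻¹] K).1 h)

/-! ### The product formula -/

theorem IsFilling.tail {C : Finset (Fin n)} {S : List (Finset (Fin n))} (h : IsFilling (C :: S)) :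
    IsFilling S :=
  ⟨fun D hD => h.1 D (List.mem_cons_of_mem _ hD), (List.pairwise_cons.1 h.2).2⟩

theorem IsFilling.card_le {C D : Finset (Fin n)} {S : List (Finset (Fin n))}
    (h : IsFilling (C :: S)) (hD : D ∈ S) : D.card ≤ C.card :=
  (List.pairwise_cons.1 h.2).1 D hD

theorem simple_mem_stab_fundWeight {ℓ : ℕ} {j : Fin (n - 1)} (h : ℓ ≤ j.val) :
    simple j ∈ stab (fundWeight n ℓ) := by
  rw [simple_mem_stab, fundWeight_eq_iff]
  simp only [lo, hi]
  omega

theorem IsParabolicExpansion.mul_gen {b : ℕ} {h : Hecke n} {c : Finset (Fin n) → Hecke n}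
    (hc : IsParabolicExpansion b h c) {j : Fin (n - 1)} (hj : simple j ∈ stab (fundWeight n b)) :
    IsParabolicExpansion b (h * gen j) fun C => c C * gen j := by
  refine ⟨fun C hC => mul_mem (hc.1 C hC) (gen_mem_parabolic hj), ?_⟩
  conv_lhs => rw [hc.2]
  rw [Finset.sum_mul]
  exact Finset.sum_congr rfl fun C _ => mul_assoc _ _ _

theorem IsParabolicExpansion.smul {b : ℕ} {h : Hecke n} {c : Finset (Fin n) → Hecke n}
    (hc : IsParabolicExpansion b h c) (r : ℤ[T;T⁻¹]) :
    IsParabolicExpansion b (r • h) fun C => r • c C := by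
  refine ⟨fun C hC => Subalgebra.smul_mem _ (hc.1 C hC) _, ?_⟩
  conv_lhs => rw [hc.2]
  rw [Finset.smul_sum]
  exact Finset.sum_congr rfl fun C _ => (mul_smul_comm _ _ _).symm

/-- Right multiplication by T_j acts on the coefficients of the expansion, so by uniqueness they
inherit the eigenvalue equation. -/
theorem parabolicCoeff_mul_gen {b : ℕ} (hb : b ≤ n) {h : Hecke n} {j : Fin (n - 1)}
    (hj : simple j ∈ stab (fundWeight n b)) (hh : h * gen j = tpow 1 • h) {C : Finset (Fin n)}
    (hC : C.card = b) :
    parabolicCoeff b h C * gen j = tpow 1 • parabolicCoeff b h C := by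
  have h1 := (isParabolicExpansion_parabolicCoeff hb h).mul_gen hj
  rw [hh] at h1
  exact h1.unique ((isParabolicExpansion_parabolicCoeff hb h).smul (tpow 1)) hC

theorem Psi_mul_gen {D : Finset (Fin n)} {S : List (Finset (Fin n))} (h : IsFilling (D :: S))
    {j : Fin (n - 1)} (hj : D.card ≤ j.val) :
    Psi (D :: S) * gen j = tpow 1 • Psi (D :: S) := by
  induction S generalizing D with
  | nil =>
    rw [Psi_singleton, mul_assoc, symmetrizer_mul_gen (simple_mem_stab_fundWeight hj),
      mul_smul_comm]
  | cons E S ih =>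
    have h1 := ih h.tail (le_trans (h.card_le List.mem_cons_self) hj)
    rw [Psi_cons_cons, mul_assoc,
      parabolicCoeff_mul_gen (card_le_n D) (simple_mem_stab_fundWeight hj) h1 rfl, mul_smul_comm]

/-- An element which is invariant under the generators beyond `a` sees the parabolic subalgebra
of `ϖ_a` through the character when it acts on a vector fixed by the generators below `a`. -/
theorem rep_mul_Tw_of_invariant {a : ℕ} {x : Hecke n}
    (hx : ∀ j : Fin (n - 1), a ≤ j.val → x * gen j = tpow 1 • x) {v : Equiv.Perm (Fin n)}
    (hv : v ∈ stab (fundWeight n a)) {z : (Fin n → ℤ) → ℤ[T;T⁻¹]}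
    (hz : ∀ j : Fin (n - 1), j.val + 1 < a → rep n (gen j) z = tpow 1 • z) :
    rep n (x * Tw v) z = tpow (len v) • rep n x z := by
  -- The vector must vary in the induction: a generator beyond a is applied to z before it can be
  -- absorbed by x.
  revert z
  refine stab_induction (antitone_fundWeight n a) (P := fun v => ∀ {z : (Fin n → ℤ) → ℤ[T;T⁻¹]},
    (∀ j : Fin (n - 1), j.val + 1 < a → rep n (gen j) z = tpow 1 • z) →
    rep n (x * Tw v) z = tpow (len v) • rep n x z) ?_ ?_ hv
  · intro z _
    rw [Tw_one, mul_one, len_one, tpow_zero, one_smul]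
  · intro v _ j hs hj ih z hz
    rw [Tw_mul_simple hj, ← mul_assoc, map_mul, Module.End.mul_apply, len_mul_simple hj, tpow_add,
      mul_smul]
    rw [simple_mem_stab, fundWeight_eq_iff] at hs
    simp only [lo, hi] at hs
    rcases Nat.lt_or_ge j.val a with h1 | h1
    · rw [hz j (hs.1 h1), map_smul, ih hz, smul_comm]
    · rw [ih, ← Module.End.mul_apply, ← map_mul, hx j h1, map_smul, LinearMap.smul_apply]
      -- T_j z still meets the hypothesis, since generators below a commute with those beyond a.
      intro i hi
      rw [← Module.End.mul_apply, ← map_mul, gen_comm (by omega), map_mul, Module.End.mul_apply,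
        hz i hi, map_smul]

/-- The columns to the right of D affect Ψ e_{ϖ_b} only by a scalar. The element c 1_{ϖ_d} is
evaluated in two ways: c acts on 1_{ϖ_d} by its character, while each T_v in 1_{ϖ_d} contributes
t^{ℓ(v)} when c T_v acts on e_{ϖ_b}. -/
theorem poincare_smul_rep_Psi {D : Finset (Fin n)} {S : List (Finset (Fin n))}
    (h : IsFilling (D :: S)) {b : ℕ} (hDb : D.card ≤ b) :
    poincare (fundWeight n D.card) • rep n (Psi (D :: S)) (basisVec (fundWeight n b)) =
      character n (Psi (D :: S)) • rep n (Psi [D]) (basisVec (fundWeight n b)) := by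
  cases S with
  | nil => rw [character_Psi_singleton]
  | cons E S =>
    set c := parabolicCoeff D.card (Psi (E :: S)) D with hc
    have hmem : c ∈ parabolic (fundWeight n D.card) :=
      (isParabolicExpansion_parabolicCoeff (card_le_n D) _).1 D
        (by rw [Finset.mem_powersetCard_univ])
    have hinv : ∀ j : Fin (n - 1), D.card ≤ j.val → c * gen j = tpow 1 • c := fun j hj =>
      parabolicCoeff_mul_gen (card_le_n D) (simple_mem_stab_fundWeight hj)
        (Psi_mul_gen h.tail (le_trans (h.card_le List.mem_cons_self) hj)) rfl
    have hz : ∀ j : Fin (n - 1), j.val + 1 < D.card →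
        rep n (gen j) (basisVec (fundWeight n b)) = tpow 1 • basisVec (fundWeight n b) :=
      fun j hj => rep_gen_basisVec_of_eq (fundWeight_eq_iff.2 (by simp only [lo, hi]; omega))
    have key : poincare (fundWeight n D.card) • rep n c (basisVec (fundWeight n b)) =
        character n c • rep n (symmetrizer (fundWeight n D.card)) (basisVec (fundWeight n b)) := by
      have h1 := congrArg (fun x => rep n x (basisVec (fundWeight n b)))
        (mul_symmetrizer_of_mem_parabolic (antitone_fundWeight n D.card) hmem)
      simp only [map_smul, LinearMap.smul_apply] at h1
      rw [← h1, symmetrizer, Finset.mul_sum, map_sum, LinearMap.sum_apply, poincare,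
        Finset.sum_smul]
      exact Finset.sum_congr rfl fun v hv => (rep_mul_Tw_of_invariant hinv hv hz).symm
    rw [Psi_cons_cons, ← hc, map_mul, map_mul, character_colElt, one_mul, Module.End.mul_apply,
      ← map_smul, key, map_smul, Psi_singleton, map_mul, Module.End.mul_apply]

theorem shape_cons (C : Finset (Fin n)) (S : List (Finset (Fin n))) :
    shape (C :: S) = fundWeight n C.card + shape S := by simp [shape]

theorem antitone_shape (T : List (Finset (Fin n))) : Antitone (shape T) := by
  induction T with
  | nil => exact fun _ _ _ => le_rfl
  | cons C S ih => rw [shape_cons]; exact (antitone_fundWeight n _).add ih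

theorem shape_nonneg (T : List (Finset (Fin n))) (i : Fin n) : 0 ≤ shape T i := by
  induction T with
  | nil => exact le_rfl
  | cons C S ih =>
    rw [shape_cons, Pi.add_apply, fundWeight]
    split_ifs <;> omega

theorem shape_pos {D : Finset (Fin n)} {S : List (Finset (Fin n))} {i : Fin n}
    (hi : i.val < D.card) : 0 < shape (D :: S) i := by
  rw [shape_cons, Pi.add_apply, fundWeight, if_pos hi]
  have := shape_nonneg S i
  omega

theorem shape_eq_zero {T : List (Finset (Fin n))} {i : Fin n} (h : ∀ C ∈ T, C.card ≤ i.val) :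
    shape T i = 0 := by
  induction T with
  | nil => rfl
  | cons C S ih =>
    rw [shape_cons, Pi.add_apply, ih fun D hD => h D (List.mem_cons_of_mem _ hD), fundWeight,
      if_neg (not_lt.2 (h C List.mem_cons_self)), add_zero]

/-- Lengths add along cosets. The first factor involves only a and b, so W_ν / W_{ν+ϖ_b} is the same
for a shape and for its first column. -/
theorem poincare_eq {ν : Fin n → ℤ} {a b : ℕ} (hν : Antitone ν)
    (hpos : ∀ i : Fin n, i.val < a → 0 < ν i) (hzero : ∀ i : Fin n, a ≤ i.val → ν i = 0)
    (hab : a ≤ b) (hbn : b ≤ n) :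
    poincare ν =
      (∑ F ∈ (Finset.powersetCard b Finset.univ).filter (fun F => highestCol n a ⊆ F),
        tpow (len (colPerm F))) * poincare (ν + fundWeight n b) := by
  rw [poincare, sum_stab_eq hν hpos hzero hab hbn, Finset.sum_mul]
  refine Finset.sum_congr rfl fun F hF => ?_
  rw [poincare, Finset.mul_sum]
  refine Finset.sum_congr rfl fun v hv => ?_
  rw [Finset.mem_filter, Finset.mem_powersetCard_univ] at hF
  rw [mem_stab_add hν (antitone_fundWeight n b), ← hF.1] at hv
  rw [(isMinRep_colPerm F).len_mul (antitone_fundWeight n _) hv.2, tpow_add]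

theorem fundWeight_pos {a : ℕ} {i : Fin n} (hi : i.val < a) : 0 < fundWeight n a i := by
  simp [fundWeight, hi]

theorem fundWeight_eq_zero {a : ℕ} {i : Fin n} (hi : a ≤ i.val) : fundWeight n a i = 0 := by
  simp [fundWeight, hi]

theorem poincare_shape_mul {C D : Finset (Fin n)} {S : List (Finset (Fin n))}
    (h : IsFilling (C :: D :: S)) :
    poincare (shape (C :: D :: S)) * poincare (fundWeight n D.card) =
      poincare (shape (D :: S)) * poincare (shape [C, D]) := by
  have hDC : D.card ≤ C.card := h.card_le List.mem_cons_self
  have h1 := poincare_eq (antitone_shape (D :: S)) (a := D.card) (fun i hi => shape_pos hi)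
    (fun i hi => shape_eq_zero fun E hE => by
      rcases List.mem_cons.1 hE with rfl | hE
      · exact hi
      · exact le_trans (h.tail.card_le hE) hi) hDC (card_le_n C)
  have h2 := poincare_eq (antitone_fundWeight n D.card) (fun i hi => fundWeight_pos hi)
    (fun i hi => fundWeight_eq_zero hi) hDC (card_le_n C)
  have e1 : shape (C :: D :: S) = shape (D :: S) + fundWeight n C.card := by
    rw [shape_cons, add_comm]
  have e2 : shape [C, D] = fundWeight n D.card + fundWeight n C.card := by
    simp [shape, add_comm]
  rw [e1, e2, h1, h2]
  ring

theorem psiTilde_nil : psiTilde ([] : List (Finset (Fin n))) = 1 := by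
  rw [psiTilde_eq, character_Psi_nil]
  exact inv_mul_cancel₀ (algebraMap_poincare_ne_zero _)

theorem psiTilde_singleton (C : Finset (Fin n)) : psiTilde [C] = 1 := by
  have e : shape [C] = fundWeight n C.card := by simp [shape]
  rw [psiTilde_eq, character_Psi_singleton, e]
  exact inv_mul_cancel₀ (algebraMap_poincare_ne_zero _)

theorem psiTilde_cons_cons {C D : Finset (Fin n)} {S : List (Finset (Fin n))}
    (h : IsFilling (C :: D :: S)) :
    psiTilde (C :: D :: S) = psiTilde [C, D] * psiTilde (D :: S) := by
  -- Evaluated at the weight of C, both sides of the proportionality become characters of Ψ.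
  have h1 := congrFun (poincare_smul_rep_Psi h.tail (b := C.card)
    (h.card_le List.mem_cons_self)) (colWeight C)
  simp only [Pi.smul_apply, smul_eq_mul, ← character_Psi_cons_cons] at h1
  have h2 := congrArg (algebraMap ℤ[T;T⁻¹] K) h1
  have h3 := congrArg (algebraMap ℤ[T;T⁻¹] K) (poincare_shape_mul h)
  simp only [map_mul] at h2 h3
  simp only [psiTilde_eq]
  have n1 := algebraMap_poincare_ne_zero (shape (C :: D :: S))
  have n2 := algebraMap_poincare_ne_zero (shape [C, D])
  have n3 := algebraMap_poincare_ne_zero (shape (D :: S))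
  have n4 := algebraMap_poincare_ne_zero (fundWeight n D.card)
  generalize algebraMap ℤ[T;T⁻¹] K (poincare (shape (C :: D :: S))) = w1 at *
  generalize algebraMap ℤ[T;T⁻¹] K (poincare (shape [C, D])) = w2 at *
  generalize algebraMap ℤ[T;T⁻¹] K (poincare (shape (D :: S))) = w3 at *
  generalize algebraMap ℤ[T;T⁻¹] K (poincare (fundWeight n D.card)) = w4 at *
  rw [inv_mul_eq_iff_eq_mul₀ n1]
  apply mul_left_cancel₀ n4
  rw [h2]
  field_simp
  linear_combination (-(algebraMap ℤ[T;T⁻¹] K (character n (Psi (D :: S))) *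
    algebraMap ℤ[T;T⁻¹] K (character n (Psi [C, D])))) * h3

theorem psiTilde_eq_prod {T : List (Finset (Fin n))} (h : IsFilling T) :
    psiTilde T = (List.zipWith (fun F E => psiTilde [F, E]) T T.tail).prod := by
  induction T with
  | nil => simp [psiTilde_nil]
  | cons C S ih =>
    cases S with
    | nil => simp [psiTilde_singleton]
    | cons D S =>
      rw [psiTilde_cons_cons h, ih h.tail]
      simp

/-! ### Combinatorics of columns -/

/-- The number of entries of the column `E` that are smaller than `k`. -/
def countBelow (E : Finset (Fin n)) (k : ℕ) : ℕ := (E.filter fun x => x.val < k).card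

theorem countBelow_eq_card (E : Finset (Fin n)) {m : ℕ} (h : E.card = m) (k : ℕ) :
    countBelow E k = (Finset.univ.filter fun i : Fin m => (E.orderEmbOfFin h i).val < k).card := by
  rw [countBelow, ← Finset.card_map (E.orderEmbOfFin h).toEmbedding]
  congr 1
  ext x
  simp only [Finset.mem_filter, Finset.mem_map, Finset.mem_univ, true_and,
    RelEmbedding.coe_toEmbedding]
  constructor
  · rintro ⟨hx, hk⟩
    have : x ∈ Set.range (E.orderEmbOfFin h) := by rwa [Finset.range_orderEmbOfFin]
    obtain ⟨i, rfl⟩ := this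
    exact ⟨i, hk, rfl⟩
  · rintro ⟨i, hi, rfl⟩
    exact ⟨Finset.orderEmbOfFin_mem _ _ _, hi⟩

theorem countBelow_n (E : Finset (Fin n)) : countBelow E n = E.card := by
  rw [countBelow, Finset.filter_true_of_mem fun x _ => x.isLt]

/-- Comparing sorted entries amounts to comparing counting functions; in this form s_j affects the
single threshold j + 1. -/
theorem semistandard_iff {F E : Finset (Fin n)} :
    Semistandard F E ↔ ∀ k, countBelow E k ≤ countBelow F k := by
  constructor
  · rintro ⟨h, hle⟩ k
    rw [countBelow_eq_card E rfl, countBelow_eq_card F rfl]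
    refine Finset.card_le_card_of_injOn (Fin.castLE h) ?_ (Fin.castLE_injective h).injOn
    intro i hi
    simp only [Finset.mem_coe, Finset.mem_filter, Finset.mem_univ, true_and] at hi ⊢
    exact lt_of_le_of_lt (hle i) hi
  · intro h
    have hc : E.card ≤ F.card := by simpa [countBelow_n] using h n
    refine ⟨hc, fun i => ?_⟩
    by_contra hlt
    rw [not_le] at hlt
    -- At the threshold given by the i-th entry of F, counted from 0, F has at most i smaller
    -- entries, while a violation gives E at least i + 1.
    have h1 := h (F.orderEmbOfFin rfl (Fin.castLE hc i)).val
    have h2 : countBelow F (F.orderEmbOfFin rfl (Fin.castLE hc i)).val ≤ i.val := by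
      rw [countBelow_eq_card F rfl]
      refine le_trans (Finset.card_le_card (t := Finset.Iio (Fin.castLE hc i)) ?_) (by simp)
      intro l hl
      simp only [Finset.mem_filter, Finset.mem_univ, true_and] at hl
      rw [Finset.mem_Iio]
      exact (F.orderEmbOfFin rfl).lt_iff_lt.1 hl
    have h3 : i.val + 1 ≤ countBelow E (F.orderEmbOfFin rfl (Fin.castLE hc i)).val := by
      rw [countBelow_eq_card E rfl]
      refine le_trans (by simp) (Finset.card_le_card (s := Finset.Iic i) ?_)
      intro l hl
      rw [Finset.mem_Iic] at hl
      simp only [Finset.mem_filter, Finset.mem_univ, true_and]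
      exact lt_of_le_of_lt ((E.orderEmbOfFin rfl).le_iff_le.2 hl) hlt
    omega

theorem colLE_iff {E F : Finset (Fin n)} (h : F.card = E.card) :
    ColLE E F ↔ ∀ k, countBelow F k ≤ countBelow E k := by
  rw [← semistandard_iff]
  constructor
  · rintro ⟨h', hle⟩
    refine ⟨h'.le, fun i => ?_⟩
    convert hle (Fin.castLE h'.le i) using 1
    exact Finset.orderEmbOfFin_eq_orderEmbOfFin_iff.2 rfl
  · rintro ⟨h', hle⟩
    refine ⟨h, fun i => ?_⟩
    convert hle (Fin.castLE h.ge i) using 1 <;>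
    exact Finset.orderEmbOfFin_eq_orderEmbOfFin_iff.2 rfl

theorem countBelow_succ (E : Finset (Fin n)) (p : Fin n) :
    countBelow E (p.val + 1) = countBelow E p.val + if p ∈ E then 1 else 0 := by
  simp only [countBelow, Finset.card_filter]
  rw [← Finset.sum_ite_eq' E p (fun _ => 1), ← Finset.sum_add_distrib]
  refine Finset.sum_congr rfl fun x _ => ?_
  rcases lt_trichotomy x.val p.val with h | h | h
  · rw [if_pos (by omega), if_pos h, if_neg (fun he => by rw [he] at h; omega), add_zero]
  · rw [if_pos (by omega), if_neg (by omega), if_pos (Fin.ext h)]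
  · rw [if_neg (by omega), if_neg (by omega), if_neg (fun he => by rw [he] at h; omega),
      add_zero]

theorem simple_val_lt_iff {j : Fin (n - 1)} {k : ℕ} (hk : k ≠ j.val + 1) (x : Fin n) :
    (simple j x).val < k ↔ x.val < k := by
  simp only [simple, Equiv.swap_apply_def, lo, hi, Fin.ext_iff]
  split_ifs <;> (try simp only) <;> omega

theorem mem_permCol_simple {j : Fin (n - 1)} {E : Finset (Fin n)} {x : Fin n} :
    x ∈ permCol (simple j) E ↔ simple j x ∈ E := by rw [mem_permCol, simple_inv]

theorem lo_mem_permCol {j : Fin (n - 1)} {E : Finset (Fin n)} :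
    lo j ∈ permCol (simple j) E ↔ hi j ∈ E := by rw [mem_permCol_simple, simple_lo]

theorem hi_mem_permCol {j : Fin (n - 1)} {E : Finset (Fin n)} :
    hi j ∈ permCol (simple j) E ↔ lo j ∈ E := by rw [mem_permCol_simple, simple_hi]

theorem permCol_permCol_simple (j : Fin (n - 1)) (E : Finset (Fin n)) :
    permCol (simple j) (permCol (simple j) E) = E := by
  ext x; rw [mem_permCol_simple, mem_permCol_simple, simple_simple]

theorem permCol_simple_eq_self {j : Fin (n - 1)} {E : Finset (Fin n)}
    (h : lo j ∈ E ↔ hi j ∈ E) : permCol (simple j) E = E := by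
  apply colWeight_injective
  rw [← permAct_colWeight, ← mem_stab, simple_mem_stab]
  simp [colWeight, h]

theorem countBelow_permCol_of_ne {j : Fin (n - 1)} {k : ℕ} (hk : k ≠ j.val + 1)
    (E : Finset (Fin n)) : countBelow (permCol (simple j) E) k = countBelow E k := by
  rw [countBelow, countBelow, ← card_permCol (simple j) (E.filter _)]
  congr 1
  ext x
  rw [mem_permCol_simple, Finset.mem_filter, Finset.mem_filter, mem_permCol_simple,
    simple_val_lt_iff hk]

theorem countBelow_lo_succ (j : Fin (n - 1)) (E : Finset (Fin n)) :
    countBelow E (j.val + 1) = countBelow E j.val + if lo j ∈ E then 1 else 0 :=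
  countBelow_succ E (lo j)

theorem countBelow_permCol_lo_succ (j : Fin (n - 1)) (E : Finset (Fin n)) :
    countBelow (permCol (simple j) E) (j.val + 1) =
      countBelow E j.val + if hi j ∈ E then 1 else 0 := by
  rw [countBelow_lo_succ, countBelow_permCol_of_ne (by omega)]
  simp only [lo_mem_permCol]

/-- Only the threshold j + 1 can change. The condition includes the case s_j E = E. -/
theorem colLE_permCol_left_iff {j : Fin (n - 1)} {E : Finset (Fin n)} :
    ColLE (permCol (simple j) E) E ↔ (lo j ∈ E → hi j ∈ E) := by
  rw [colLE_iff (card_permCol _ _).symm]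
  constructor
  · intro h h1
    have := h (j.val + 1)
    rw [countBelow_lo_succ, countBelow_permCol_lo_succ, if_pos h1] at this
    by_contra h2
    rw [if_neg h2] at this
    omega
  · intro h k
    rcases eq_or_ne k (j.val + 1) with rfl | hk
    · rw [countBelow_lo_succ, countBelow_permCol_lo_succ]
      by_cases h1 : lo j ∈ E
      · simp [h1, h h1]
      · simp [h1]
    · rw [countBelow_permCol_of_ne hk]

theorem colLE_permCol_right_iff {j : Fin (n - 1)} {F : Finset (Fin n)} :
    ColLE F (permCol (simple j) F) ↔ (hi j ∈ F → lo j ∈ F) := by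
  have := colLE_permCol_left_iff (j := j) (E := permCol (simple j) F)
  rwa [permCol_permCol_simple, lo_mem_permCol, hi_mem_permCol] at this

theorem exists_simple_of_ne_highestCol {E : Finset (Fin n)} (hE : E ≠ highestCol n E.card) :
    ∃ j : Fin (n - 1), lo j ∉ E ∧ hi j ∈ E := by
  by_contra! h
  -- Without such a j the column is closed downwards, hence an initial segment; m is the distance
  -- between the two letters.
  have hdown : ∀ m : ℕ, ∀ p q : Fin n, p ∈ E → q.val + m = p.val → q ∈ E := by
    intro m
    induction m with
    | zero =>
      intro p q hp hq
      rwa [show q = p from Fin.ext (by omega)]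
    | succ m ih =>
      intro p q hp hq
      have hlt : q.val < n - 1 := by have := p.isLt; omega
      by_contra hn
      exact h ⟨q.val, hlt⟩ hn (ih p _ hp (by simp only [hi]; omega))
  apply hE
  refine Finset.eq_of_subset_of_card_le (fun p hp => ?_) (card_highestCol (card_le_n E)).le
  rw [mem_highestCol]
  have : Finset.Iic p ⊆ E := fun q hq =>
    hdown (p.val - q.val) p q hp (by
      have := Fin.le_def.1 (Finset.mem_Iic.1 hq)
      omega)
  have := Finset.card_le_card this
  rw [Fin.card_Iic] at this
  omega

/-- Induction on columns along the operators `s_j` that decrease a column. -/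
theorem column_induction {P : Finset (Fin n) → Prop}
    (highest : ∀ E, E = highestCol n E.card → P E)
    (step : ∀ E (j : Fin (n - 1)), lo j ∉ E → hi j ∈ E → P (permCol (simple j) E) → P E)
    (E : Finset (Fin n)) : P E := by
  -- Replacing `hi j` by `lo j` lowers the sum of the entries.
  induction hk : ∑ x ∈ E, x.val using Nat.strong_induction_on generalizing E with
  | _ k ih =>
    by_cases hE : E = highestCol n E.card
    · exact highest E hE
    obtain ⟨j, h1, h2⟩ := exists_simple_of_ne_highestCol hE
    refine step E j h1 h2 (ih _ ?_ _ rfl)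
    rw [← hk, permCol, Finset.sum_map]
    refine Finset.sum_lt_sum (fun x hx => ?_) ⟨hi j, h2, ?_⟩
    · by_cases hx2 : x = hi j
      · subst hx2
        simpa [simple_hi] using (lo_lt_hi j).le
      · have hx1 : x ≠ lo j := fun he => h1 (he ▸ hx)
        simp [simple_apply_of_ne hx1 hx2]
    · simpa [simple_hi] using lo_lt_hi j

/-! ### The recursion for `Ψ` on single columns -/

theorem colPerm_inv_val_lt_iff {E : Finset (Fin n)} {x : Fin n} :
    ((colPerm E)⁻¹ x).val < E.card ↔ x ∈ E := by
  rw [← colPerm_mem_iff]; simp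

theorem colPerm_permCol_simple {E : Finset (Fin n)} {j : Fin (n - 1)} (h1 : lo j ∉ E)
    (h2 : hi j ∈ E) : colPerm (permCol (simple j) E) = simple j * colPerm E := by
  have hm := isMinRep_colPerm (permCol (simple j) E)
  have hp := permAct_colPerm (permCol (simple j) E)
  rw [card_permCol] at hm hp
  refine IsMinRep.ext (antitone_fundWeight n E.card) hm ?_ ?_
  · intro p q hpq h
    refine simple_lt_simple j (isMinRep_colPerm E p q hpq h) ?_
    rintro ⟨hp, hq⟩
    rw [fundWeight_eq_iff, ← colPerm_mem_iff, ← colPerm_mem_iff, hp, hq] at h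
    exact h1 (h.2 h2)
  · rw [hp, permAct_mul, permAct_colPerm, permAct_colWeight]

/-- Here T_{u⁻¹} = T_{u⁻¹s_j} T_j, so T_j cancels against the inverse, and the length drop of one
leaves the factor t. -/
theorem gen_mul_colElt_of_mem {E : Finset (Fin n)} {j : Fin (n - 1)} (h1 : lo j ∉ E)
    (h2 : hi j ∈ E) : gen j * colElt E = tpow 1 • colElt (permCol (simple j) E) := by
  have hlt : (colPerm E)⁻¹ (hi j) < (colPerm E)⁻¹ (lo j) := by
    rw [Fin.lt_def]
    have h3 := colPerm_inv_val_lt_iff.2 h2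
    have h4 := mt colPerm_inv_val_lt_iff.1 h1
    omega
  have hl := len_simple_mul_of_gt hlt
  have hT := Tw_mul_simple (w := (colPerm E)⁻¹ * simple j) (j := j)
    (by simpa [simple_lo, simple_hi] using hlt)
  rw [mul_simple_simple] at hT
  rw [colElt, colElt, colPerm_permCol_simple h1 h2, ← hl, hT, mul_inv_rev, simple_inv, add_comm,
    tpow_add, mul_smul, mul_smul_comm, mul_smul_comm]
  congr 2
  have hX := isUnit_Tw ((colPerm E)⁻¹ * simple j)
  apply hX.mul_left_cancel
  rw [← mul_assoc, Ring.mul_inverse_cancel _ (hX.mul (isUnit_gen j)), Ring.mul_inverse_cancel _ hX]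

/-- With u = u_E, the conjugate v = u⁻¹ s_j u lies in the stabilizer of the fundamental weight and
T_v T_{u⁻¹} = T_{u⁻¹} T_j. Thus T_j passes through the inverse as T_v and is absorbed by the
symmetrizer. -/
theorem gen_mul_Psi_of_fixed {E : Finset (Fin n)} {j : Fin (n - 1)}
    (h : lo j ∈ E ↔ hi j ∈ E) : gen j * Psi [E] = tpow 1 • Psi [E] := by
  have hfix := permCol_simple_eq_self (E := E) (j := j) (by simp [h])
  set u := colPerm E with hu
  have hlt : u⁻¹ (lo j) < u⁻¹ (hi j) := by
    rcases lt_or_gt_of_ne (apply_lo_ne_apply_hi u⁻¹ j) with h1 | h1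
    · exact h1
    · have h2 := isMinRep_colPerm E _ _ h1 (by
        rw [fundWeight_eq_iff, hu, colPerm_inv_val_lt_iff, colPerm_inv_val_lt_iff, h])
      rw [← hu] at h2
      exact absurd (by simpa using h2) (lo_lt_hi j).not_gt
  have hv : u⁻¹ * simple j * u ∈ stab (fundWeight n E.card) := by
    rw [mem_stab, permAct_mul, permAct_mul, hu, permAct_colPerm, permAct_colWeight, hfix,
      ← permAct_colPerm, ← permAct_mul, inv_mul_cancel, permAct_one]
  have h3 := (isMinRep_colPerm E).Tw_inv_mul (antitone_fundWeight n _) hv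
  have e : (u⁻¹ * simple j * u)⁻¹ = u⁻¹ * simple j * u := by
    simp [mul_inv_rev, simple_inv, mul_assoc]
  rw [← hu, e, mul_assoc (u⁻¹ * simple j), mul_inv_cancel, mul_one, Tw_mul_simple hlt] at h3
  -- Characters yield t^{ℓ(v)} = t without identifying v as a simple transposition.
  have h4 := congrArg (character n) h3
  rw [map_mul, map_mul, character_gen, character_Tw, character_Tw, mul_comm] at h4
  have h5 := (isUnit_tpow _).mul_right_cancel h4
  have hX := isUnit_Tw u⁻¹
  have h6 : gen j * Ring.inverse (Tw u⁻¹) = Ring.inverse (Tw u⁻¹) * Tw (u⁻¹ * simple j * u) := by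
    apply hX.mul_left_cancel
    rw [← mul_assoc, h3, mul_assoc, Ring.mul_inverse_cancel _ hX, mul_one, ← mul_assoc,
      Ring.mul_inverse_cancel _ hX, one_mul]
  rw [Psi_singleton, colElt, ← hu, smul_mul_assoc, mul_smul_comm, ← mul_assoc, h6, mul_assoc,
    Tw_mul_symmetrizer (antitone_fundWeight n _) hv, ← h5, mul_smul_comm, smul_comm]

theorem gen_mul_Psi {E : Finset (Fin n)} {j : Fin (n - 1)} (h : lo j ∈ E → hi j ∈ E) :
    gen j * Psi [E] = tpow 1 • Psi [permCol (simple j) E] := by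
  by_cases h1 : lo j ∈ E
  · have hfix := permCol_simple_eq_self (E := E) (j := j) (by simp [h1, h h1])
    rw [hfix, gen_mul_Psi_of_fixed (iff_of_true h1 (h h1))]
  · by_cases h2 : hi j ∈ E
    · rw [Psi_singleton, Psi_singleton, ← mul_assoc, gen_mul_colElt_of_mem h1 h2, card_permCol,
        smul_mul_assoc]
    · have hfix := permCol_simple_eq_self (E := E) (j := j) (by simp [h1, h2])
      rw [hfix, gen_mul_Psi_of_fixed (iff_of_false h1 h2)]

/-- Solves `gen_mul_Psi` for Ψ_E, using t T_j⁻¹ = T_j + 1 - t. -/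
theorem Psi_singleton_eq {E : Finset (Fin n)} {j : Fin (n - 1)} (h : lo j ∈ E → hi j ∈ E) :
    Psi [E] = gen j * Psi [permCol (simple j) E] + (1 - tpow 1) • Psi [permCol (simple j) E] := by
  apply (isUnit_tpow 1).smul_left_cancel.1
  rw [smul_add, ← mul_smul_comm, smul_comm, ← gen_mul_Psi h, ← mul_assoc, gen_mul_self, add_mul,
    smul_mul_assoc, smul_mul_assoc, one_mul, add_right_comm, ← add_smul]
  rw [show (tpow 1 - 1 : ℤ[T;T⁻¹]) + (1 - tpow 1) = 0 by ring, zero_smul, zero_add]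

/-! ### Two columns -/

/-- The numerator of `ψ̃_{F ⊗ E}`. -/
def psiNum (F E : Finset (Fin n)) : ℤ[T;T⁻¹] :=
  rep n (Psi [E]) (basisVec (fundWeight n F.card)) (colWeight F)

theorem psiTilde_pair_eq (F E : Finset (Fin n)) :
    psiTilde [F, E] =
      (algebraMap ℤ[T;T⁻¹] K (poincare (fundWeight n F.card + fundWeight n E.card)))⁻¹ *
        algebraMap ℤ[T;T⁻¹] K (psiNum F E) := by
  rw [psiTilde_eq, character_Psi_cons_cons, psiNum]
  simp [shape]

theorem psiNum_eq (F : Finset (Fin n)) {E : Finset (Fin n)} {j : Fin (n - 1)}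
    (h : lo j ∈ E → hi j ∈ E) :
    psiNum F E =
      rep n (gen j) (rep n (Psi [permCol (simple j) E]) (basisVec (fundWeight n F.card)))
        (colWeight F) + (1 - tpow 1) * psiNum F (permCol (simple j) E) := by
  rw [psiNum, Psi_singleton_eq h, map_add, map_smul, map_mul]
  rfl

/-- The term (t - 1) f(F) produced by T_j cancels (1 - t) f(F); if s_j F = F, the coefficients t and
1 - t add up to 1. -/
theorem psiNum_of_le {F E : Finset (Fin n)} {j : Fin (n - 1)} (hE : lo j ∈ E → hi j ∈ E)
    (hF : lo j ∈ F → hi j ∈ F) : psiNum F E = psiNum (permCol (simple j) F)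
      (permCol (simple j) E) := by
  rw [psiNum_eq F hE, rep_gen_apply, permAct_colWeight]
  simp only [psiNum, card_permCol]
  by_cases h2 : hi j ∈ F
  · by_cases h1 : lo j ∈ F
    · have hfix := permCol_simple_eq_self (E := F) (j := j) (by simp [h1, h2])
      rw [hfix, if_pos (by simp [colWeight, h1, h2])]
      ring
    · rw [if_neg (by simp [colWeight, h1, h2]), if_neg (by simp [colWeight, h1, h2])]
      ring
  · have h1 : lo j ∉ F := fun h1 => h2 (hF h1)
    have hfix := permCol_simple_eq_self (E := F) (j := j) (by simp [h1, h2])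
    rw [hfix, if_pos (by simp [colWeight, h1, h2])]
    ring

theorem psiNum_of_ge {F E : Finset (Fin n)} {j : Fin (n - 1)} (hE : lo j ∈ E → hi j ∈ E)
    (hF : hi j ∈ F → lo j ∈ F) :
    psiNum F E = tpow 1 * psiNum (permCol (simple j) F) (permCol (simple j) E) +
      (1 - tpow 1) * psiNum F (permCol (simple j) E) := by
  rw [psiNum_eq F hE, rep_gen_apply, permAct_colWeight]
  simp only [psiNum, card_permCol]
  congr 1
  by_cases h : lo j ∈ F ↔ hi j ∈ F
  · have hfix := permCol_simple_eq_self (E := F) (j := j) (by simp [h])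
    rw [hfix, if_pos (by simp [colWeight, h])]
  · have h1 : lo j ∈ F := by by_contra h1; exact h (iff_of_false h1 (mt hF h1))
    have h2 : hi j ∉ F := fun h2 => h (iff_of_true h1 h2)
    rw [if_neg (by simp [colWeight, h1, h2]), if_pos (by simp [colWeight, h1, h2])]

/-! ### The highest weight column and the vanishing condition. -/

theorem colPerm_highestCol {a : ℕ} (ha : a ≤ n) : colPerm (highestCol n a) = 1 := by
  have hm := isMinRep_colPerm (highestCol n a)
  have hp := permAct_colPerm (highestCol n a)
  rw [card_highestCol ha] at hm hp
  refine IsMinRep.ext (antitone_fundWeight n a) hm (fun p q hpq _ => hpq) ?_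
  rw [hp, colWeight_highestCol, permAct_one]

theorem Psi_highestCol {a : ℕ} (ha : a ≤ n) :
    Psi [highestCol n a] = symmetrizer (fundWeight n a) := by
  rw [Psi_singleton, card_highestCol ha, colElt, colPerm_highestCol ha, len_one, inv_one, Tw_one,
    Ring.inverse_one, tpow_zero, one_smul, one_mul]

/-- Splitting 1_{ϖ_a} over cosets, the coset of each C ⊇ {1, …, a} sends e_{ϖ_b} to W_{ϖ_a+ϖ_b} e_C.
-/
theorem psiNum_highestCol {a : ℕ} {F : Finset (Fin n)} (ha : a ≤ F.card) :
    psiNum F (highestCol n a) =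
      if highestCol n a ⊆ F then poincare (fundWeight n F.card + fundWeight n a) else 0 := by
  have hb := card_le_n F
  rw [psiNum, Psi_highestCol (ha.trans hb), symmetrizer, map_sum, LinearMap.sum_apply,
    sum_stab_eq (antitone_fundWeight n a) (fun i hi => fundWeight_pos hi)
      (fun i hi => fundWeight_eq_zero hi) ha hb]
  have key : ∀ C ∈ (Finset.powersetCard F.card Finset.univ).filter (fun C => highestCol n a ⊆ C),
      ∑ v ∈ stab (fundWeight n a + fundWeight n F.card),
        rep n (Tw (colPerm C * v)) (basisVec (fundWeight n F.card)) =
      poincare (fundWeight n F.card + fundWeight n a) • basisVec (colWeight C) := by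
    intro C hC
    rw [Finset.mem_filter, Finset.mem_powersetCard_univ] at hC
    rw [poincare, Finset.sum_smul, add_comm]
    refine Finset.sum_congr rfl fun v hv => ?_
    rw [mem_stab_add (antitone_fundWeight n _) (antitone_fundWeight n _)] at hv
    rw [← hC.1] at hv ⊢
    rw [(isMinRep_colPerm C).Tw_mul (antitone_fundWeight n _) hv.1, map_mul,
      Module.End.mul_apply, rep_Tw_basisVec_of_mem_stab (antitone_fundWeight n _) hv.1, map_smul,
      rep_Tw_colPerm]
  rw [Finset.sum_congr rfl key, Finset.sum_apply]
  simp only [Pi.smul_apply, basisVec_apply, colWeight_injective.eq_iff, smul_eq_mul, mul_ite,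
    mul_one, mul_zero, Finset.sum_ite_eq, Finset.mem_filter, Finset.mem_powersetCard_univ,
    true_and]

/-- By induction on E, some term of the recursion is nonzero, and semistandardness of its pair of
columns passes back to F ⊗ E. -/
theorem countBelow_le_of_psiNum_ne_zero {F E : Finset (Fin n)} (hc : E.card ≤ F.card)
    (h : psiNum F E ≠ 0) (k : ℕ) : countBelow E k ≤ countBelow F k := by
  induction E using column_induction generalizing F k with
  | highest E hE =>
    rw [hE, psiNum_highestCol hc] at h
    have hsub : highestCol n E.card ⊆ F := by
      by_contra hn
      exact h (if_neg hn)
    rw [← hE] at hsub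
    exact Finset.card_le_card (Finset.filter_subset_filter _ hsub)
  | step E j h1 h2 ih =>
    have hE : lo j ∈ E → hi j ∈ E := fun _ => h2
    have hE' : ∀ k, countBelow E k ≤ countBelow (permCol (simple j) E) k := by
      rw [← colLE_iff (card_permCol _ _).symm]
      exact colLE_permCol_left_iff.2 hE
    -- Away from j + 1 the counts do not change under s_j. At j + 1 the count of E equals its count
    -- at j, since `lo j` is not in E.
    have hA : psiNum (permCol (simple j) F) (permCol (simple j) E) ≠ 0 →
        countBelow E k ≤ countBelow F k := by
      intro h3
      have ih' := fun k => ih (by rwa [card_permCol, card_permCol]) h3 k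
      have hne : ∀ k, k ≠ j.val + 1 → countBelow E k ≤ countBelow F k := by
        intro k hk
        have := ih' k
        rwa [countBelow_permCol_of_ne hk, countBelow_permCol_of_ne hk] at this
      by_cases hk : k = j.val + 1
      · rw [hk, countBelow_lo_succ, countBelow_lo_succ, if_neg h1]
        have := hne j.val (by omega)
        omega
      · exact hne k hk
    by_cases hF : lo j ∈ F → hi j ∈ F
    · exact hA (by rwa [psiNum_of_le hE hF] at h)
    · have hF' : hi j ∈ F → lo j ∈ F := fun _ => by
        by_contra h3
        exact hF fun h4 => absurd h4 h3
      rw [psiNum_of_ge hE hF'] at h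
      by_cases h3 : psiNum (permCol (simple j) F) (permCol (simple j) E) = 0
      · refine le_trans (hE' k) (ih (by rwa [card_permCol]) (fun h4 => h ?_) k)
        rw [h3, h4, mul_zero, mul_zero, add_zero]
      · exact hA h3

/-- At threshold a, F must have a entries among the a smallest letters. -/
theorem highestCol_subset_of_semistandard {a : ℕ} (ha : a ≤ n) {F : Finset (Fin n)}
    (h : Semistandard F (highestCol n a)) : highestCol n a ⊆ F := by
  have h1 := semistandard_iff.1 h a
  have h2 : countBelow (highestCol n a) a = a := by
    rw [countBelow, Finset.filter_true_of_mem fun x hx => mem_highestCol.1 hx, card_highestCol ha]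
  have h3 : (F.filter fun x => x.val < a) = highestCol n a :=
    Finset.eq_of_subset_of_card_le
      (fun x hx => mem_highestCol.2 (Finset.mem_filter.1 hx).2)
      (by rw [card_highestCol ha, ← h2]; exact h2.symm ▸ h1)
  rw [← h3]
  exact Finset.filter_subset _ _

/-! ### The recursions for ψ̃ and their uniqueness. -/

theorem satisfiesRecursions_psiTilde {a b : ℕ} (hab : a ≤ b) (hbn : b ≤ n) :
    SatisfiesRecursions (n := n) a b (fun F E => psiTilde [F, E]) where
  not_semistandard F E hF hE hns := by
    rw [semistandard_iff] at hns
    have h0 : psiNum F E = 0 := by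
      by_contra h
      exact hns (countBelow_le_of_psiNum_ne_zero (by omega) h)
    rw [psiTilde_pair_eq, h0, map_zero, mul_zero]
  highest_weight F E hF hE hEh hss := by
    subst hEh
    have hsub := highestCol_subset_of_semistandard (hab.trans hbn) hss
    rw [psiTilde_pair_eq, psiNum_highestCol (by omega), if_pos hsub, hE]
    exact inv_mul_cancel₀ (algebraMap_poincare_ne_zero _)
  rec_ge F E hF hE _ j hEj hFj := by
    rw [colLE_permCol_left_iff] at hEj
    rw [colLE_permCol_right_iff] at hFj
    simp only [psiTilde_pair_eq, card_permCol]
    rw [psiNum_of_ge hEj hFj, map_add, map_mul, map_mul, map_sub, map_one, tK]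
    ring
  rec_le F E hF hE _ j hEj hFj := by
    rw [colLE_permCol_left_iff] at hEj hFj
    simp only [psiTilde_pair_eq, card_permCol]
    rw [psiNum_of_le hEj hFj]

/-- For every F at least one of s_jF ≤ F and F ≤ s_jF holds, and both rules involve only the lower
column s_jE. The induction must therefore range over all F. -/
theorem SatisfiesRecursions.unique {a b : ℕ} {φ φ' : Finset (Fin n) → Finset (Fin n) → K}
    (h : SatisfiesRecursions a b φ) (h' : SatisfiesRecursions a b φ') {F E : Finset (Fin n)}
    (hF : F.card = b) (hE : E.card = a) : φ F E = φ' F E := by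
  induction E using column_induction generalizing F with
  | highest E hEh =>
    rw [hE] at hEh
    by_cases hss : Semistandard F E
    · rw [h.highest_weight F E hF hE hEh hss, h'.highest_weight F E hF hE hEh hss]
    · rw [h.not_semistandard F E hF hE hss, h'.not_semistandard F E hF hE hss]
  | step E j h1 h2 ih =>
    by_cases hss : Semistandard F E
    · have hEj : ColLE (permCol (simple j) E) E := colLE_permCol_left_iff.2 fun _ => h2
      have hE' : (permCol (simple j) E).card = a := by rw [card_permCol, hE]
      have hF' : (permCol (simple j) F).card = b := by rw [card_permCol, hF]
      by_cases hFj : ColLE (permCol (simple j) F) F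
      · rw [h.rec_le F E hF hE hss j hEj hFj, h'.rec_le F E hF hE hss j hEj hFj, ih hF' hE']
      · have hFj' : ColLE F (permCol (simple j) F) := by
          rw [colLE_permCol_left_iff] at hFj
          rw [colLE_permCol_right_iff]
          exact fun _ => by
            by_contra h3
            exact hFj fun h4 => absurd h4 h3
        rw [h.rec_ge F E hF hE hss j hEj hFj', h'.rec_ge F E hF hE hss j hEj hFj', ih hF' hE',
          ih hF hE']
    · rw [h.not_semistandard F E hF hE hss, h'.not_semistandard F E hF hE hss]

end

end HeckeTableaux

open HeckeTableaux
theorem theorem7p1 (n : ℕ) (hn : 0 < n) :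
    -- the scalars are well defined by their defining equation
    (∀ T : List (Finset (Fin n)), IsFilling T →
      IsPsiTilde T (psiTilde T) ∧ ∀ c : K, IsPsiTilde T c → c = psiTilde T) ∧
    -- (1) the product formula over pairs of neighbouring columns
    (∀ T : List (Finset (Fin n)), IsFilling T →
      psiTilde T = (List.zipWith (fun F E => psiTilde [F, E]) T T.tail).prod) ∧
    -- (2) the two-column scalars satisfy the recursions and are determined by them
    (∀ a b : ℕ, 1 ≤ a → a ≤ b → b ≤ n →
      SatisfiesRecursions (n := n) a b (fun F E => psiTilde [F, E]) ∧
      ∀ φ : Finset (Fin n) → Finset (Fin n) → K, SatisfiesRecursions a b φ →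
        ∀ F E : Finset (Fin n), F.card = b → E.card = a → φ F E = psiTilde [F, E]) := by
  refine ⟨fun T _ => ⟨(isPsiTilde_iff T _).2 (psiTilde_eq T), fun c hc => ?_⟩,
    fun T hT => psiTilde_eq_prod hT, fun a b _ hab hbn => ?_⟩
  · rw [psiTilde_eq]
    exact (isPsiTilde_iff T c).1 hc
  · have h := satisfiesRecursions_psiTilde hab hbn
    exact ⟨h, fun φ hφ F E hF hE => hφ.unique h hF hE⟩
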